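/- **Setting.** Let $G=(V,E)$ be a finite, simple, connected $k$-regular graph with $k\ge 1$ and $n=|V|$ vertices (the users). Let $\mathcal A_{ldp}$ be a local randomizer, which assigns to every $x\in\mathcal D$ a probability measure $\mathcal A_{ldp}(x)$ on a measurable space $\mathcal S$. It is $(\varepsilon_0,\delta_0)$-DP if $\Pr[\mathcal A_{ldp}(x)\in E]\le e^{\varepsilon_0}\Pr[\mathcal A_{ldp}(x')\in E]+\delta_0$ for all $x,x'\in\mathcal D$ and all measurable $E\subseteq\mathcal S$, and it is an $\varepsilon_0$-local randomizer if this holds with $\delta_0=0$. Fix a dummy input $\mathbf 0\in\mathcal D$ and a number of rounds $t\ge 0$. The protocol $\mathcal A_{single}:\mathcal D^n\to\mathcal S^n$ runs as follows on $x=(x_j)_{j\in V}$. User $j$ draws the report $s_j\sim\mathcal A_{ldp}(x_j)$. In each of $t$ rounds, every report is sent, independently of all others, by its current holder to a uniformly random neighbour of the holder. Afterwards each user submits to the server one report chosen uniformly at random among those she holds, or, if she holds none, a fresh dummy report drawn from $\mathcal A_{ldp}(\mathbf 0)$. The output is the vector of the $n$ submissions, indexed by the submitting user. Let $M_{ij}=A_{ij}/\sum_l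 A_{il}$ be the transition matrix ($A$ is the adjacency matrix). For a user $u$, let $P^{(u)}=(M^{T})^t e_u$ be the exact position probability distribution at time $t$ of the report produced by $u$. Put $Q_u=\sum_{i\in V}(P^{(u)}_i)^2$ and $Q=\max_u Q_u$ (so $Q=Q_u$ for every $u$ if the walk looks the same from all users). A mechanism on $\mathcal D^n$ is $(\varepsilon,\delta)$-DP at index $u$ if $\Pr[\mathcal M(x)\in E]\le e^{\varepsilon}\Pr[\mathcal M(x')\in E]+\delta$ for all measurable $E$ and all $x,x'$ that differ at most in the entry of $u$. It is $(\varepsilon,\delta)$-DP if it is so at every index. **Theorem ("Single" protocol, symmetric distribution).** Let $\varepsilon_0\ge 0$ and $0<\delta<1$. 1. If $\mathcal A_{ldp}$ is an $\varepsilon_0$-local randomizer, then for every user $u$, $\mathcal A_{single}$ is $(\varepsilon(Q_u),\delta)$-DP at index $u$, and $\mathcal A_{single}$ is $(\varepsilon(Q),\delta)$-DP, where $$\varepsilon(q)=\frac{e^{2\varepsilon_0}(e^{\varepsilon_0}-1)^2}{2}\,q+e^{\varepsilon_0}(e^{\varepsilon_0}-1)\sqrt{2\log\tfrac1\delta\;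 q}.$$ 2. Let $0<\delta_1<1$ and $\delta_2\ge 0$, and let $\mathcal A_{ldp}$ be $(\varepsilon_0,\delta_0)$-DP with $$0\le\delta_0\le\frac{(1-e^{-\varepsilon_0})\,\delta_1}{4e^{\varepsilon_0}\left(2+\frac{\ln(2/\delta_1)}{\ln\left(1/(1-e^{-5\varepsilon_0})\right)}\right)}$$ (the right-hand side is read as $0$ for $\varepsilon_0=0$). Then for every user $u$, $\mathcal A_{single}$ is $(\varepsilon'(Q_u),\delta'(Q_u))$-DP at index $u$, and $\mathcal A_{single}$ is $(\varepsilon'(Q),\delta'(Q))$-DP, where $$\varepsilon'(q)=\frac{e^{16\varepsilon_0}(e^{8\varepsilon_0}-1)^2}{2}\,q+e^{8\varepsilon_0}(e^{8\varepsilon_0}-1)\sqrt{2\log\tfrac1\delta\; q},\qquad \delta'(q)=\delta+\delta_2+n\,(e^{\varepsilon'(q)}+1)\,\delta_1 .$$ 3. If in addition $\varepsilon_0\le 1$, the guarantees of part 2 also hold with $$\varepsilon'(q)=800\,\varepsilon_0^2\,q+40\,\varepsilon_0\sqrt{2\log\tfrac1\delta\; q},\qquad \delta'(q)=\delta+\delta_2+n\,(e^{\varepsilon'(q)}+1)\,\delta_1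 .$$ -/

import Mathlib

open MeasureTheory

noncomputable section

/-! Differential privacy. -/

/-- The one-sided inequality `μ(E) ≤ e^ε ν(E) + δ` over all measurable events `E`. -/
def Indist {Ω : Type*} [MeasurableSpace Ω] (μ ν : Measure Ω) (ε δ : ℝ) : Prop :=
  ∀ E : Set Ω, MeasurableSet E →
    μ E ≤ ENNReal.ofReal (Real.exp ε) * ν E + ENNReal.ofReal δ

/-- A randomized map `A : D → S` (given by its output laws) is an `(ε, δ)`-DP local randomizer. -/
def IsLocalRandomizer {D S : Type*} [MeasurableSpace S] (A : D → Measure S) (ε δ : ℝ) : Prop :=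
  ∀ x x' : D, Indist (A x) (A x') ε δ

/-- `(ε, δ)`-DP at index `u`: the two datasets differ at most in the entry of user `u`. -/
def IsDPAt {V D Ω : Type*} [MeasurableSpace Ω] (M : (V → D) → Measure Ω) (u : V) (ε δ : ℝ) :
    Prop :=
  ∀ x x' : V → D, (∀ v, v ≠ u → x v = x' v) → Indist (M x) (M x') ε δ

/-- `(ε, δ)`-DP: the two datasets differ in (at most) one entry. -/
def IsDP {V D Ω : Type*} [MeasurableSpace Ω] (M : (V → D) → Measure Ω) (ε δ : ℝ) : Prop :=
  ∀ x x' : V → D, (∃ u, ∀ v, v ≠ u → x v = x' v) → Indist (M x) (M x') ε δ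

/-! Random walk on a graph. -/

section Walk

variable {V : Type*} [Fintype V] [DecidableEq V] (G : SimpleGraph V) [DecidableRel G.Adj]

/-- Transition probabilities `M i j = A i j / ∑ j, A i j`, with `A` the adjacency matrix. -/
def transitionMatrix : Matrix V V ℝ :=
  Matrix.of fun i j => G.adjMatrix ℝ i j / ∑ l, G.adjMatrix ℝ i l

/-- Position probability distribution `P(t) = (Mᵀ)^t P(0)` of the report produced by user `u`
(`P(0)` is the point mass at `u`); the `i`-th entry is the probability that user `i` holds it. -/
def positionDist (t : ℕ) (u : V) : V → ℝ :=
  ((transitionMatrix G).transpose ^ t).mulVec (Pi.single u 1)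

/-- `∑ i, (P i)²` for the position probability distribution `P` of user `u` at time `t`. -/
def collision (t : ℕ) (u : V) : ℝ :=
  ∑ i, positionDist G t u i ^ 2

/-! The "single" protocol. A configuration `y : V → V` maps (the producer of) each report
to the user who currently holds it. -/

/-- Law of the configuration after `t` rounds. Initially each user holds her own report; in each
round every report is sent, independently, to a uniformly random neighbour of its holder. -/
def configProb : ℕ → (V → V) → ℝ
  | 0, y => if y = id then 1 else 0
  | t + 1, y => ∑ z : V → V, configProb t z * ∏ j, transitionMatrix G (z j) (y j)

/-- The reports held by user `i` in configuration `y`. -/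
def heldReports {V : Type*} [Fintype V] [DecidableEq V] (y : V → V) (i : V) : Finset V :=
  Finset.univ.filter fun j => y j = i

/-- Probability that user `i` submits a given report (`some j`: the report produced by `j`;
`none`: a dummy report). She picks uniformly among the reports she holds, and submits a dummy
report exactly when she holds none. -/
def pickProb {V : Type*} [Fintype V] [DecidableEq V] (y : V → V) (i : V) : Option V → ℝ
  | none => if heldReports y i = ∅ then 1 else 0
  | some j => if j ∈ heldReports y i then 1 / ((heldReports y i).card : ℝ) else 0

/-- Law of the vector of submissions received by the server on dataset `x`. The reports
`s j ~ A (x j)` and the dummy reports `r i ~ A dummy` are drawn independently of each other, of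
the routing `y` and of the picks `c`; user `i` submits `s j` if `c i = some j`, else `r i`. -/
def singleProtocol {D S : Type*} [MeasurableSpace S] (A : D → Measure S) (dummy : D) (t : ℕ)
    (x : V → D) : Measure (V → S) :=
  ∑ y : V → V, ∑ c : V → Option V,
    ENNReal.ofReal (configProb G t y * ∏ i, pickProb y i (c i)) •
      Measure.map (fun (p : (V → S) × (V → S)) (i : V) => (c i).elim (p.2 i) p.1)
        ((Measure.pi fun j => A (x j)).prod (Measure.pi fun _ => A dummy))

end Walk

/-! Privacy parameters. -/

/-- `e^{2ε₀}(e^{ε₀}-1)²/2 · Q + e^{ε₀}(e^{ε₀}-1) √(2 log(1/δ) Q)`, where `Q = ∑ i, (P i)²`. -/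
def singleEps (ε₀ δ Q : ℝ) : ℝ :=
  Real.exp (2 * ε₀) * (Real.exp ε₀ - 1) ^ 2 / 2 * Q +
    Real.exp ε₀ * (Real.exp ε₀ - 1) * Real.sqrt (2 * Real.log (1 / δ) * Q)

/-- `800 ε₀² Q + 40 ε₀ √(2 log(1/δ) Q)`, where `Q = ∑ i, (P i)²`. -/
def singleEpsSmall (ε₀ δ Q : ℝ) : ℝ :=
  800 * ε₀ ^ 2 * Q + 40 * ε₀ * Real.sqrt (2 * Real.log (1 / δ) * Q)

/-- The largest admissible `δ₀` for given `ε₀` and `δ₁` (it is `0` for `ε₀ = 0`). -/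
def deltaThreshold (ε₀ δ₁ : ℝ) : ℝ :=
  (1 - Real.exp (-ε₀)) * δ₁ /
    (4 * Real.exp ε₀ *
      (2 + Real.log (2 / δ₁) / Real.log (1 / (1 - Real.exp (-5 * ε₀)))))

/-- `δ + δ₂ + n (e^{ε'} + 1) δ₁`. -/
def singleDelta (n : ℕ) (ε' δ δ₁ δ₂ : ℝ) : ℝ :=
  δ + δ₂ + n * (Real.exp ε' + 1) * δ₁

end

/-! Fix the routes of all reports other than that of `u`, and the picks each user would make without
it. The report of `u` reaches user `i` with probability `P i`, and `i` submits it with probability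
`1 / (m + 1)`, where `m` counts her other reports. So, conditionally, the output is a product law in
which coordinate `i` is redrawn from `A (x u)` with probability `q i ≤ P i`, and nothing is redrawn
otherwise (`sum_configProb_mul`, `isDPAt_singleProtocol_of_mixtureLaw`). Only the redrawn law
depends on the entry of `u`, and `∑ q i ^ 2 ≤ Q`.

It remains to compare two such mixtures. Relative to the base product law their densities are `1 + ∑
q i * (f i (s i) - 1)` and the same with `g`. Integrating the Rényi integrand over one coordinate at
a time changes each density by a factor close to `1`; the logarithm of the quotient of the two
factors is at most `a * q i` in absolute value (`CloseRatios.step_le`), so Hoeffding's lemma makes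
the step cost `exp ((r + r ^ 2) * (a * q i) ^ 2 / 2)`. The product of the costs depends on `∑ q i ^
2` alone, and a Chernoff bound with the best `r` gives `a ^ 2 / 2 * Q + a * √(2 log (1/δ) Q)`
(`indist_mixture`).

A pure randomizer allows `a = e^ε₀ (e^ε₀ - 1)`. For an approximate one, clipping and normalising the
densities (`exists_bounded_density`) allows `a = e^(3ε₀) - 1` at a total variation cost of `2 δ₀`
per mixture; both forms of `ε'` dominate this value of `a`. -/

/-! ### Scalar inequalities: Hoeffding's lemma and the one-coordinate likelihood ratio. -/

/-- Here `X` plays a log-likelihood ratio under its numerator law. Hoeffding at `s = -1` together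
with `h1` bounds the mean by `ε ^ 2 / 2`; Hoeffding at `s = r` then finishes. -/
theorem integral_exp_mul_le_of_abs_le {Ω : Type*} [MeasurableSpace Ω] {P : Measure Ω}
    [IsProbabilityMeasure P] {X : Ω → ℝ} (hm : Measurable X) {ε : ℝ} (hε : ∀ ω, |X ω| ≤ ε)
    (h1 : 1 ≤ ∫ ω, Real.exp (-X ω) ∂P) {r : ℝ} (hr : 0 ≤ r) :
    ∫ ω, Real.exp (r * X ω) ∂P ≤ Real.exp ((r + r ^ 2) * (ε ^ 2 / 2)) := by
  have hb : ∀ᵐ ω ∂P, X ω ∈ Set.Icc (-ε) ε := ae_of_all _ fun ω => abs_le.mp (hε ω)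
  have hsg := ProbabilityTheory.hasSubgaussianMGF_of_mem_Icc hm.aemeasurable hb
  set m := ∫ ω, X ω ∂P
  have key : ∀ s : ℝ, ∫ ω, Real.exp (s * X ω) ∂P ≤ Real.exp (s * m + ε ^ 2 * s ^ 2 / 2) := by
    intro s
    have h := hsg.mgf_le s
    rw [ProbabilityTheory.mgf] at h
    have e1 : ∀ ω, Real.exp (s * (X ω - m)) = Real.exp (-(s * m)) * Real.exp (s * X ω) := by
      intro ω; rw [← Real.exp_add]; ring_nf
    simp only [e1] at h
    rw [integral_const_mul] at h
    have e2 : (((‖ε - -ε‖₊ / 2) ^ 2 : NNReal) : ℝ) = ε ^ 2 := by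
      push_cast
      rw [div_pow, Real.norm_eq_abs, sq_abs]; ring
    rw [e2] at h
    calc ∫ ω, Real.exp (s * X ω) ∂P
        = Real.exp (s * m) * (Real.exp (-(s * m)) * ∫ ω, Real.exp (s * X ω) ∂P) := by
          rw [← mul_assoc, ← Real.exp_add]; simp
      _ ≤ Real.exp (s * m) * Real.exp (ε ^ 2 * s ^ 2 / 2) := by gcongr
      _ = _ := by rw [← Real.exp_add]
  have hm2 : m ≤ ε ^ 2 / 2 := by
    have h := key (-1)
    simp only [neg_mul, one_mul] at h
    have h' := h1.trans h
    rw [Real.one_le_exp_iff] at h'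
    linarith
  refine (key r).trans (Real.exp_le_exp.mpr ?_)
  nlinarith

theorem one_add_mul_le_exp_posPart {c q F f : ℝ} (hc : 1 ≤ c) (hq : 0 ≤ q)
    (hF : 1 / c ≤ F) : 1 + q / F * (f - 1) ≤ Real.exp (q * (c * max (f - 1) 0)) := by
  have hc0 : 0 < c := by linarith
  have hF0 : 0 < F := lt_of_lt_of_le (by positivity) hF
  have hr : q / F ≤ q * c := by
    rw [div_le_iff₀ hF0]
    rw [div_le_iff₀ hc0] at hF
    nlinarith
  have h0 : 0 ≤ q / F := by positivity
  calc 1 + q / F * (f - 1) ≤ 1 + q / F * max (f - 1) 0 := by gcongr; exact le_max_left _ _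
    _ ≤ 1 + q * c * max (f - 1) 0 := by gcongr
    _ ≤ _ := by rw [mul_assoc, add_comm]; exact Real.add_one_le_exp _

/-- The bound `1 / c ≤ G` would be too weak here, since `1 / (1 - x)` exceeds `exp x`. With the
sharper `hG` and `g ≤ 1`, put `x = c * (1 - g)` and `y = c * g - 1`, both nonnegative with sum `c -
1`: the claim follows from `(1 + q * x) * (1 + q * y) ≥ 1 + q * (x + y)`. -/
theorem one_le_exp_posPart_mul {c q G g : ℝ} (hc : 1 ≤ c) (hq : 0 ≤ q)
    (hG : q + (1 - q) / c ≤ G) (hg : 1 / c ≤ g) :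
    1 ≤ Real.exp (q * (c * max (1 - g) 0)) * (1 + q / G * (g - 1)) := by
  have hc0 : 0 < c := by linarith
  have hD : 0 < 1 + q * (c - 1) := by nlinarith
  have hG' : 1 + q * (c - 1) ≤ G * c := by
    have : (q + (1 - q) / c) * c ≤ G * c := by gcongr
    have e : (q + (1 - q) / c) * c = 1 + q * (c - 1) := by field_simp; ring
    linarith
  have hG0 : 0 < G := by
    by_contra h
    nlinarith
  have hr0 : 0 ≤ q / G := by positivity
  have hcg : 1 ≤ c * g := by rw [div_le_iff₀ hc0] at hg; linarith
  rcases le_total 1 g with h | h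
  · rw [max_eq_right (by linarith)]
    simp only [mul_zero, Real.exp_zero, one_mul]
    nlinarith
  · rw [max_eq_left (by linarith)]
    have hr : q / G ≤ q * c / (1 + q * (c - 1)) := by
      rw [div_le_div_iff₀ hG0 hD]; nlinarith
    have hN : 1 ≤ 1 + q * (c * g - 1) := by nlinarith
    have h2 : (1 + q * (c * g - 1)) / (1 + q * (c - 1)) ≤ 1 + q / G * (g - 1) := by
      have e : (1 + q * (c * g - 1)) / (1 + q * (c - 1))
          = 1 + q * c / (1 + q * (c - 1)) * (g - 1) := by field_simp; ring
      rw [e]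
      nlinarith
    have h3 : 1 + q * (c * (1 - g)) ≤ Real.exp (q * (c * (1 - g))) := by
      rw [add_comm]; exact Real.add_one_le_exp _
    have hx : 0 ≤ q * (c * (1 - g)) := by
      have : 0 ≤ 1 - g := by linarith
      positivity
    calc (1 : ℝ) ≤ (1 + q * (c * (1 - g))) * ((1 + q * (c * g - 1)) / (1 + q * (c - 1))) := by
          rw [← mul_div_assoc, le_div_iff₀ hD]
          nlinarith
      _ ≤ _ := by gcongr

/-- Two likelihood ratios `f`, `g` with values in `[1/c, c]`, with `a` bounding `c` times their
pairwise deviations (and their deviations from `1`). -/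
structure CloseRatios (c a f g : ℝ) : Prop where
  left_ge : 1 / c ≤ f
  right_ge : 1 / c ≤ g
  left_le : f ≤ c
  right_le : g ≤ c
  dev_left : c * |f - 1| ≤ a
  dev_right : c * |g - 1| ≤ a
  dev : c * |f - g| ≤ a

theorem CloseRatios.symm {c a f g : ℝ} (h : CloseRatios c a f g) : CloseRatios c a g f :=
  ⟨h.2, h.1, h.4, h.3, h.6, h.5, by rw [abs_sub_comm]; exact h.7⟩

theorem CloseRatios.add_mul_pos {c a f g q F : ℝ} (h : CloseRatios c a f g) (hc : 1 ≤ c)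
    (hq : 0 ≤ q) (hF : q + (1 - q) / c ≤ F) : 0 < F + q * (f - 1) := by
  have hc0 : 0 < c := by linarith
  have h1 : 0 < 1 / c := by positivity
  have h2 := h.left_ge
  have : q + (1 - q) / c = q + (1 - q) * (1 / c) := by ring
  nlinarith

theorem CloseRatios.step_le {c a f g q F G : ℝ} (h : CloseRatios c a f g) (hc : 1 ≤ c)
    (hq : 0 ≤ q) (hF : q + (1 - q) / c ≤ F) (hG : q + (1 - q) / c ≤ G) :
    1 + q / F * (f - 1) ≤ Real.exp (a * q) * (1 + q / G * (g - 1)) := by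
  have hc0 : 0 < c := by linarith
  have hge : 1 / c ≤ q + (1 - q) / c := by
    have : 1 / c ≤ 1 := by rw [div_le_one hc0]; exact hc
    have e : q + (1 - q) / c = 1 / c + q * (1 - 1 / c) := by ring
    nlinarith
  have h1 := one_add_mul_le_exp_posPart (f := f) hc hq (hge.trans hF)
  have h2 := one_le_exp_posPart_mul hc hq hG h.right_ge
  -- If both positive parts are active they add up to `c * (f - g)`; otherwise one deviation from
  -- `1` bounds the sum.
  have hsum : c * max (f - 1) 0 + c * max (1 - g) 0 ≤ a := by
    have d1 := h.dev_left
    have d2 := h.dev_right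
    have d3 := h.dev
    have ha : 0 ≤ a := le_trans (by positivity) d1
    have l1 := mul_le_mul_of_nonneg_left (le_abs_self (f - 1)) hc0.le
    have l2 := mul_le_mul_of_nonneg_left (neg_abs_le (g - 1)) hc0.le
    have l3 := mul_le_mul_of_nonneg_left (le_abs_self (f - g)) hc0.le
    rcases max_cases (f - 1) 0 with ⟨e1, _⟩ | ⟨e1, _⟩ <;>
    rcases max_cases (1 - g) 0 with ⟨e2, _⟩ | ⟨e2, _⟩ <;> rw [e1, e2] <;> nlinarith
  have hpos : 0 ≤ 1 + q / G * (g - 1) := by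
    by_contra hn
    have := Real.exp_pos (q * (c * max (1 - g) 0))
    nlinarith
  calc 1 + q / F * (f - 1) ≤ Real.exp (q * (c * max (f - 1) 0)) * 1 := by rw [mul_one]; exact h1
    _ ≤ Real.exp (q * (c * max (f - 1) 0)) *
        (Real.exp (q * (c * max (1 - g) 0)) * (1 + q / G * (g - 1))) := by gcongr
    _ = Real.exp (q * (c * max (f - 1) 0 + c * max (1 - g) 0)) * (1 + q / G * (g - 1)) := by
        rw [← mul_assoc, ← Real.exp_add]; ring_nf
    _ ≤ _ := by
        have := mul_le_mul_of_nonneg_left hsum hq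
        exact mul_le_mul_of_nonneg_right (Real.exp_le_exp.mpr (by linarith)) hpos

/-! ### Rényi moment of a single coordinate. -/

/-- The integrand `X ^ (1 + r) * Y ^ (-r)` of a Rényi divergence. -/
noncomputable def renyiIntegrand (r X Y : ℝ) : ENNReal := ENNReal.ofReal (X * (X / Y) ^ r)

theorem integral_one_add_mul_sub_one {S : Type*} [MeasurableSpace S] {b : Measure S}
    [IsProbabilityMeasure b] {f : S → ℝ} (hf : Integrable f b) (hf1 : ∫ s, f s ∂b = 1) (t : ℝ) :
    ∫ s, 1 + t * (f s - 1) ∂b = 1 := by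
  have h : Integrable (fun s => t * (f s - 1)) b := (hf.sub (integrable_const _)).const_mul _
  rw [integral_add (integrable_const _) h, integral_const_mul, integral_sub hf (integrable_const _),
    hf1]
  simp

/-- Factoring out `F` and `G` leaves the densities `u = 1 + q / F * (f - 1)` and `v = 1 + q / G * (g
- 1)`, each of mass one. Under `u · b` the variable `log (u / v)` is bounded by `a * q`, so the
Hoeffding estimate applies. -/
theorem lintegral_renyiIntegrand_step {S : Type*} [MeasurableSpace S] {b : Measure S}
    [IsProbabilityMeasure b] {f g : S → ℝ} (hf : Measurable f) (hg : Measurable g)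
    (hf1 : ∫ s, f s ∂b = 1) (hg1 : ∫ s, g s ∂b = 1)
    {c a : ℝ} (hc : 1 ≤ c) (h : ∀ s, CloseRatios c a (f s) (g s))
    {q F G : ℝ} (hq : 0 ≤ q) (hq1 : q ≤ 1) (hF : q + (1 - q) / c ≤ F)
    (hG : q + (1 - q) / c ≤ G) {r : ℝ} (hr : 0 ≤ r) :
    ∫⁻ s, renyiIntegrand r (F + q * (f s - 1)) (G + q * (g s - 1)) ∂b ≤
      ENNReal.ofReal (Real.exp ((r + r ^ 2) * ((a * q) ^ 2 / 2))) * renyiIntegrand r F G := by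
  have hc0 : 0 < c := by linarith
  have hb0 : 0 < q + (1 - q) / c := by
    rcases hq.eq_or_lt with rfl | hq'
    · simpa using hc0
    · have : 0 ≤ (1 - q) / c := div_nonneg (by linarith) hc0.le
      linarith
  have hF0 : 0 < F := hb0.trans_le hF
  have hG0 : 0 < G := hb0.trans_le hG
  have hpF : ∀ s, 0 < F + q * (f s - 1) := fun s => (h s).add_mul_pos hc hq hF
  have hpG : ∀ s, 0 < G + q * (g s - 1) := fun s => (h s).symm.add_mul_pos hc hq hG
  set u : S → ℝ := fun s => 1 + q / F * (f s - 1) with hu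
  set v : S → ℝ := fun s => 1 + q / G * (g s - 1) with hv
  have eF : ∀ s, F + q * (f s - 1) = F * u s := fun s => by simp only [hu]; field_simp
  have eG : ∀ s, G + q * (g s - 1) = G * v s := fun s => by simp only [hv]; field_simp
  have hup : ∀ s, 0 < u s := fun s => by have := hpF s; rw [eF] at this; exact pos_of_mul_pos_right this hF0.le
  have hvp : ∀ s, 0 < v s := fun s => by have := hpG s; rw [eG] at this; exact pos_of_mul_pos_right this hG0.le
  have hum : Measurable u := by fun_prop
  have hvm : Measurable v := by fun_prop
  have hfi : Integrable f b := .of_bound hf.aestronglyMeasurable c (ae_of_all _ fun s => by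
    rw [Real.norm_eq_abs, abs_of_nonneg (le_trans (by positivity) (h s).left_ge)]
    exact (h s).left_le)
  have hgi : Integrable g b := .of_bound hg.aestronglyMeasurable c (ae_of_all _ fun s => by
    rw [Real.norm_eq_abs, abs_of_nonneg (le_trans (by positivity) (h s).right_ge)]
    exact (h s).right_le)
  have hui : Integrable u b := (integrable_const _).add ((hfi.sub (integrable_const _)).const_mul _)
  have hvi : Integrable v b := (integrable_const _).add ((hgi.sub (integrable_const _)).const_mul _)
  have hu1 : ∫ s, u s ∂b = 1 := integral_one_add_mul_sub_one hfi hf1 _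
  have hv1 : ∫ s, v s ∂b = 1 := integral_one_add_mul_sub_one hgi hg1 _
  set P := b.withDensity fun s => ENNReal.ofReal (u s) with hP
  have hPp : IsProbabilityMeasure P := by
    constructor
    rw [hP, withDensity_apply _ MeasurableSet.univ, Measure.restrict_univ,
      ← ofReal_integral_eq_lintegral_ofReal hui (ae_of_all _ fun s => (hup s).le), hu1]
    simp
  have hint : ∀ φ : S → ℝ, ∫ s, φ s ∂P = ∫ s, u s * φ s ∂b := fun φ => by
    rw [hP, integral_withDensity_eq_integral_toReal_smul (by fun_prop) (by simp)]
    simp [ENNReal.toReal_ofReal (hup _).le]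
  set X : S → ℝ := fun s => Real.log (u s / v s) with hX
  have hXm : Measurable X := by fun_prop
  have hXb : ∀ s, |X s| ≤ a * q := by
    intro s
    have s1 := (h s).step_le hc hq hF hG
    have s2 := (h s).symm.step_le hc hq hG hF
    rw [abs_le]
    constructor
    · rw [hX]
      simp only
      rw [Real.le_log_iff_exp_le (div_pos (hup s) (hvp s)), le_div_iff₀ (hvp s), Real.exp_neg,
        inv_mul_le_iff₀ (Real.exp_pos _)]
      exact s2
    · rw [hX]
      simp only
      rw [Real.log_le_iff_le_exp (div_pos (hup s) (hvp s)), div_le_iff₀ (hvp s)]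
      exact s1
  have hXexp : ∀ s (t : ℝ), Real.exp (t * X s) = (u s / v s) ^ t := fun s t => by
    rw [Real.rpow_def_of_pos (div_pos (hup s) (hvp s)), mul_comm]
  -- Under `P = u · b`, the integral of `exp (-X) = v / u` is the mass of `v`.
  have h1 : 1 ≤ ∫ s, Real.exp (-X s) ∂P := by
    rw [hint]
    have : ∀ s, u s * Real.exp (-X s) = v s := fun s => by
      rw [hX]; simp only
      rw [Real.exp_neg, Real.exp_log (div_pos (hup s) (hvp s)), inv_div]
      field_simp [(hup s).ne']
    simp only [this]
    exact hv1.ge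
  have main := integral_exp_mul_le_of_abs_le hXm hXb h1 hr
  rw [hint] at main
  have e : ∀ s, renyiIntegrand r (F + q * (f s - 1)) (G + q * (g s - 1)) =
      renyiIntegrand r F G * ENNReal.ofReal (u s * Real.exp (r * X s)) := by
    intro s
    rw [renyiIntegrand, renyiIntegrand, ← ENNReal.ofReal_mul (by positivity), eF, eG, hXexp,
      mul_div_mul_comm, Real.mul_rpow (by positivity) (div_pos (hup s) (hvp s)).le]
    congr 1; ring
  have hXi : Integrable (fun s => u s * Real.exp (r * X s)) b := by
    refine hui.mul_bdd (c := Real.exp (r * (a * q))) (by fun_prop) (ae_of_all _ fun s => ?_)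
    rw [Real.norm_eq_abs, Real.abs_exp, Real.exp_le_exp]
    exact mul_le_mul_of_nonneg_left ((le_abs_self _).trans (hXb s)) hr
  simp only [e]
  rw [lintegral_const_mul _ (by fun_prop), mul_comm]
  gcongr
  rw [← ofReal_integral_eq_lintegral_ofReal hXi (ae_of_all _ fun s => mul_nonneg (hup s).le (Real.exp_pos _).le)]
  exact ENNReal.ofReal_le_ofReal main

/-! ### Rényi moments of mixtures and the Chernoff bound. -/

section Mixture

variable {V S : Type*}

/-- The likelihood ratio `1 + ∑ i ∈ T, q i * (f i (s i) - 1)` of the mixture which, with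
probability `q i`, tilts coordinate `i` by `f i`. -/
def mixtureRatio (q : V → ℝ) (f : V → S → ℝ) (T : Finset V) (s : V → S) : ℝ :=
  1 + ∑ i ∈ T, q i * (f i (s i) - 1)

variable {q : V → ℝ} {f g : V → S → ℝ}

theorem measurable_mixtureRatio [MeasurableSpace S] (hf : ∀ i, Measurable (f i)) (T : Finset V) :
    Measurable (mixtureRatio q f T) := by
  unfold mixtureRatio
  fun_prop

/-- The worst case has `f j = 1 / c` throughout `T`, whose weights total at most `1 - q i` because
`i ∉ T`. This is the sharp lower bound required by `one_le_exp_posPart_mul`. -/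
theorem le_mixtureRatio [Fintype V] [DecidableEq V] {c : ℝ} (hc : 1 ≤ c) (hq : ∀ i, 0 ≤ q i)
    (hq1 : ∑ i, q i ≤ 1) (hf : ∀ i s, 1 / c ≤ f i s) {T : Finset V} {i : V} (hi : i ∉ T)
    (s : V → S) : q i + (1 - q i) / c ≤ mixtureRatio q f T s := by
  have hc0 : 0 < c := by linarith
  have hc1 : 1 / c ≤ 1 := by rw [div_le_one hc0]; exact hc
  have h1 : ∑ j ∈ insert i T, q j ≤ 1 :=
    (Finset.sum_le_univ_sum_of_nonneg hq).trans hq1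
  rw [Finset.sum_insert hi] at h1
  have h2 : ∑ j ∈ T, q j * (1 / c - 1) ≤ ∑ j ∈ T, q j * (f j (s j) - 1) :=
    Finset.sum_le_sum fun j _ => mul_le_mul_of_nonneg_left (by linarith [hf j (s j)]) (hq j)
  rw [← Finset.sum_mul] at h2
  have e : q i + (1 - q i) / c = 1 + (1 - q i) * (1 / c - 1) := by ring
  rw [mixtureRatio, e]
  nlinarith

theorem mixtureRatio_update [DecidableEq V] {T : Finset V} {i : V} (hi : i ∉ T) (s : V → S)
    (z : S) : mixtureRatio q f (insert i T) (Function.update s i z) =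
      mixtureRatio q f T s + q i * (f i z - 1) := by
  simp only [mixtureRatio]
  rw [Finset.sum_insert hi, Function.update_self, Finset.sum_congr rfl (g := fun j =>
    q j * (f j (s j) - 1))]
  · ring
  · intro j hj
    rw [Function.update_of_ne (by rintro rfl; exact hi hj)]

theorem measurable_renyiIntegrand_comp {Ω : Type*} [MeasurableSpace Ω] {X Y : Ω → ℝ}
    (hX : Measurable X) (hY : Measurable Y) (r : ℝ) :
    Measurable fun s => renyiIntegrand r (X s) (Y s) := by
  unfold renyiIntegrand
  fun_prop

/-- Coordinates in `T` are already integrated out, which leaves the ratios truncated to `Tᶜ`: each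
term `f i - 1` has mean zero under `b i`. Each new coordinate costs one application of the
single-coordinate step. -/
theorem lmarginal_renyiIntegrand_le [Fintype V] [DecidableEq V] [MeasurableSpace S]
    {b : V → Measure S} [∀ i, IsProbabilityMeasure (b i)] (hf : ∀ i, Measurable (f i))
    (hg : ∀ i, Measurable (g i)) (hf1 : ∀ i, ∫ s, f i s ∂b i = 1)
    (hg1 : ∀ i, ∫ s, g i s ∂b i = 1) {c a : ℝ} (hc : 1 ≤ c)
    (h : ∀ i s, CloseRatios c a (f i s) (g i s)) (hq : ∀ i, 0 ≤ q i) (hq1 : ∑ i, q i ≤ 1)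
    {r : ℝ} (hr : 0 ≤ r) (T : Finset V) (s : V → S) :
    lmarginal b T (fun s => renyiIntegrand r (mixtureRatio q f .univ s)
        (mixtureRatio q g .univ s)) s ≤
      ENNReal.ofReal (Real.exp ((r + r ^ 2) * (a ^ 2 * ∑ i ∈ T, q i ^ 2 / 2))) *
        renyiIntegrand r (mixtureRatio q f Tᶜ s) (mixtureRatio q g Tᶜ s) := by
  induction T using Finset.induction generalizing s with
  | empty => simp
  | insert i T hi ih =>
    have hi' : i ∉ (insert i T)ᶜ := by simp
    have hins : Tᶜ = insert i (insert i T)ᶜ := by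
      ext j; simp only [Finset.mem_compl, Finset.mem_insert]
      by_cases hj : j = i
      · subst hj; simp [hi]
      · simp [hj]
    rw [lmarginal_insert _ (measurable_renyiIntegrand_comp (measurable_mixtureRatio hf _)
      (measurable_mixtureRatio hg _) r) hi]
    refine (lintegral_mono fun z => ih (Function.update s i z)).trans ?_
    rw [hins]
    simp only [mixtureRatio_update hi']
    rw [lintegral_const_mul _ (measurable_renyiIntegrand_comp (by have := hf i; fun_prop)
      (by have := hg i; fun_prop) r)]
    have hqi : q i ≤ 1 := (Finset.single_le_sum (fun j _ => hq j) (Finset.mem_univ i)).trans hq1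
    refine (mul_le_mul_right (lintegral_renyiIntegrand_step (hf i) (hg i) (hf1 i) (hg1 i) hc (h i)
      (hq i) hqi (le_mixtureRatio hc hq hq1 (fun j z => (h j z).left_ge) hi' s)
      (le_mixtureRatio hc hq hq1 (fun j z => (h j z).right_ge) hi' s) hr) _).trans ?_
    rw [← mul_assoc, ← ENNReal.ofReal_mul (Real.exp_pos _).le, ← Real.exp_add,
      Finset.sum_insert hi]
    apply le_of_eq
    congr 3
    ring

theorem lintegral_renyiIntegrand_le [Fintype V] [DecidableEq V] [MeasurableSpace S]
    {b : V → Measure S} [∀ i, IsProbabilityMeasure (b i)] (hf : ∀ i, Measurable (f i))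
    (hg : ∀ i, Measurable (g i)) (hf1 : ∀ i, ∫ s, f i s ∂b i = 1)
    (hg1 : ∀ i, ∫ s, g i s ∂b i = 1) {c a : ℝ} (hc : 1 ≤ c)
    (h : ∀ i s, CloseRatios c a (f i s) (g i s)) (hq : ∀ i, 0 ≤ q i) (hq1 : ∑ i, q i ≤ 1)
    {r : ℝ} (hr : 0 ≤ r) :
    ∫⁻ s, renyiIntegrand r (mixtureRatio q f .univ s) (mixtureRatio q g .univ s) ∂Measure.pi b ≤
      ENNReal.ofReal (Real.exp ((r + r ^ 2) * (a ^ 2 * ∑ i, q i ^ 2 / 2))) := by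
  -- The full marginal needs a base point; one exists because a probability measure cannot live on
  -- an empty space.
  obtain ⟨s⟩ : Nonempty (V → S) := by
    by_contra hne
    have := not_nonempty_iff.mp hne
    have h1 := measure_univ (μ := Measure.pi b)
    rw [Set.univ_eq_empty_iff.mpr this, measure_empty] at h1
    exact zero_ne_one h1
  rw [lintegral_eq_lmarginal_univ s]
  refine (lmarginal_renyiIntegrand_le hf hg hf1 hg1 hc h hq hq1 hr .univ s).trans ?_
  simp [mixtureRatio, renyiIntegrand]

/-- Chernoff bound: a Rényi moment bound for densities gives an `(ε, δ)` bound. -/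
theorem indist_withDensity_of_renyi {Ω : Type*} [MeasurableSpace Ω] {P : Measure Ω}
    {F G : Ω → ℝ} (hF : Measurable F) (hG : Measurable G) (hF0 : ∀ ω, 0 ≤ F ω)
    (hG0 : ∀ ω, 0 < G ω) {r ε δ : ℝ} (hr : 0 ≤ r)
    (h : ∫⁻ ω, renyiIntegrand r (F ω) (G ω) ∂P ≤ ENNReal.ofReal (Real.exp (r * ε) * δ)) :
    Indist (P.withDensity fun ω => ENNReal.ofReal (F ω))
      (P.withDensity fun ω => ENNReal.ofReal (G ω)) ε δ := by
  intro E hE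
  rw [withDensity_apply _ hE, withDensity_apply _ hE]
  -- Where `F` exceeds `exp ε * G`, the factor `(F / G) ^ r` is at least `exp (r * ε)`, so the Rényi
  -- term alone dominates `F`.
  have hpt : ∀ ω, ENNReal.ofReal (F ω) ≤ ENNReal.ofReal (Real.exp ε) * ENNReal.ofReal (G ω) +
      ENNReal.ofReal (Real.exp (-(r * ε))) * renyiIntegrand r (F ω) (G ω) := by
    intro ω
    rw [renyiIntegrand, ← ENNReal.ofReal_mul (Real.exp_pos _).le,
      ← ENNReal.ofReal_mul (Real.exp_pos _).le]
    have hn : 0 ≤ Real.exp (-(r * ε)) * (F ω * (F ω / G ω) ^ r) :=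
      mul_nonneg (Real.exp_pos _).le (mul_nonneg (hF0 ω)
        (Real.rpow_nonneg (div_nonneg (hF0 ω) (hG0 ω).le) _))
    rw [← ENNReal.ofReal_add (mul_nonneg (Real.exp_pos _).le (hG0 ω).le) hn]
    apply ENNReal.ofReal_le_ofReal
    rcases le_total (F ω) (Real.exp ε * G ω) with hle | hle
    · linarith
    · have h1 : Real.exp ε ≤ F ω / G ω := by rwa [le_div_iff₀ (hG0 ω)]
      have h2 : Real.exp (r * ε) ≤ (F ω / G ω) ^ r := by
        rw [mul_comm, Real.exp_mul]
        exact Real.rpow_le_rpow (Real.exp_pos _).le h1 hr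
      have h3 : F ω ≤ Real.exp (-(r * ε)) * (F ω * (F ω / G ω) ^ r) := by
        calc F ω = Real.exp (-(r * ε)) * (F ω * Real.exp (r * ε)) := by
              rw [mul_left_comm, ← Real.exp_add]; simp
          _ ≤ _ := by have := hF0 ω; gcongr
      have := mul_nonneg (Real.exp_pos ε).le (hG0 ω).le
      linarith
  refine (lintegral_mono hpt).trans ?_
  have hm := measurable_renyiIntegrand_comp hF hG r
  rw [lintegral_add_left (by fun_prop), lintegral_const_mul _ (by fun_prop),
    lintegral_const_mul _ hm]
  gcongr
  calc _ ≤ ENNReal.ofReal (Real.exp (-(r * ε))) * ENNReal.ofReal (Real.exp (r * ε) * δ) := by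
        gcongr
        exact (setLIntegral_le_lintegral _ _).trans h
    _ = ENNReal.ofReal δ := by
        rw [← ENNReal.ofReal_mul (Real.exp_pos _).le, ← mul_assoc, ← Real.exp_add]
        simp

theorem indist_mixture [Fintype V] [DecidableEq V] [MeasurableSpace S]
    {b : V → Measure S} [∀ i, IsProbabilityMeasure (b i)] (hf : ∀ i, Measurable (f i))
    (hg : ∀ i, Measurable (g i)) (hf1 : ∀ i, ∫ s, f i s ∂b i = 1)
    (hg1 : ∀ i, ∫ s, g i s ∂b i = 1) {c a : ℝ} (hc : 1 ≤ c) (ha : 0 < a)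
    (h : ∀ i s, CloseRatios c a (f i s) (g i s)) (hq : ∀ i, 0 ≤ q i) (hq1 : ∑ i, q i ≤ 1)
    {Q δ : ℝ} (hQ : ∑ i, q i ^ 2 ≤ Q) (hQ0 : 0 < Q) (hδ : 0 < δ) (hδ1 : δ < 1) :
    Indist ((Measure.pi b).withDensity fun s => ENNReal.ofReal (mixtureRatio q f .univ s))
      ((Measure.pi b).withDensity fun s => ENNReal.ofReal (mixtureRatio q g .univ s))
      (a ^ 2 / 2 * Q + a * Real.sqrt (2 * Real.log (1 / δ) * Q)) δ := by
  have hc0 : 0 < c := by linarith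
  have pos : ∀ f : V → S → ℝ, (∀ i s, 1 / c ≤ f i s) → ∀ s, 0 < mixtureRatio q f .univ s := by
    intro f hf s
    have h2 : ∑ j, q j * (1 / c - 1) ≤ ∑ j, q j * (f j (s j) - 1) :=
      Finset.sum_le_sum fun j _ => mul_le_mul_of_nonneg_left (by linarith [hf j (s j)]) (hq j)
    rw [← Finset.sum_mul] at h2
    have hc1 : 1 / c ≤ 1 := by rw [div_le_one hc0]; exact hc
    have hc2 : 0 < 1 / c := by positivity
    rw [mixtureRatio]
    nlinarith
  have hlog : 0 < Real.log (1 / δ) := Real.log_pos (by rw [lt_div_iff₀ hδ]; linarith)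
  set w := Real.sqrt (2 * Real.log (1 / δ) * Q) with hw
  have hw2 : w ^ 2 = 2 * Real.log (1 / δ) * Q := Real.sq_sqrt (by positivity)
  -- This order maximises `r * a * w - r ^ 2 * a ^ 2 * Q / 2`; the maximum is `w ^ 2 / (2 * Q) = log
  -- (1 / δ)`, so no slack remains.
  have hr : 0 ≤ w / (a * Q) := by positivity
  refine indist_withDensity_of_renyi (measurable_mixtureRatio hf _) (measurable_mixtureRatio hg _)
    (fun s => (pos f (fun i s => (h i s).left_ge) s).le) (pos g (fun i s => (h i s).right_ge))
    hr ((lintegral_renyiIntegrand_le hf hg hf1 hg1 hc h hq hq1 hr).trans ?_)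
  apply ENNReal.ofReal_le_ofReal
  have e1 : δ = Real.exp (-Real.log (1 / δ)) := by simp [Real.exp_log hδ]
  conv_rhs => rw [e1]
  rw [← Real.exp_add, Real.exp_le_exp, ← Finset.sum_div]
  have e2 : Real.log (1 / δ) = w ^ 2 / (2 * Q) := by rw [hw2]; field_simp
  rw [e2]
  set r := w / (a * Q) with hrdef
  have e3 : w = r * a * Q := by rw [hrdef]; field_simp
  calc (r + r ^ 2) * (a ^ 2 * ((∑ i, q i ^ 2) / 2)) ≤ (r + r ^ 2) * (a ^ 2 * (Q / 2)) := by
        gcongr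
    _ = _ := by rw [e3]; field_simp; ring

end Mixture

/-! ### Composition of closeness bounds, and mixtures as measures. -/

theorem Indist.trans_zero_left {Ω : Type*} [MeasurableSpace Ω] {μ ν ρ : Measure Ω} {ε δ η : ℝ}
    (hδ : 0 ≤ δ) (hη : 0 ≤ η) (h : Indist μ ν 0 η) (h' : Indist ν ρ ε δ) :
    Indist μ ρ ε (δ + η) := by
  intro E hE
  have h1 := h E hE
  rw [Real.exp_zero, ENNReal.ofReal_one, one_mul] at h1
  rw [ENNReal.ofReal_add hδ hη, ← add_assoc]
  exact h1.trans (by gcongr; exact h' E hE)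

theorem Indist.trans_zero_right {Ω : Type*} [MeasurableSpace Ω] {μ ν ρ : Measure Ω} {ε δ η : ℝ}
    (hδ : 0 ≤ δ) (hη : 0 ≤ η) (h : Indist μ ν ε δ) (h' : Indist ν ρ 0 η) :
    Indist μ ρ ε (δ + Real.exp ε * η) := by
  intro E hE
  have h1 := h' E hE
  rw [Real.exp_zero, ENNReal.ofReal_one, one_mul] at h1
  rw [ENNReal.ofReal_add hδ (by positivity), ENNReal.ofReal_mul (Real.exp_pos _).le]
  calc μ E ≤ ENNReal.ofReal (Real.exp ε) * ν E + ENNReal.ofReal δ := h E hE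
    _ ≤ ENNReal.ofReal (Real.exp ε) * (ρ E + ENNReal.ofReal η) + ENNReal.ofReal δ := by gcongr
    _ = _ := by ring

theorem Indist.mono {Ω : Type*} [MeasurableSpace Ω] {μ ν : Measure Ω} {ε ε' δ δ' : ℝ}
    (h : Indist μ ν ε δ) (hε : ε ≤ ε') (hδ : δ ≤ δ') : Indist μ ν ε' δ' := fun E hE =>
  (h E hE).trans (by gcongr)

theorem measurable_update_prod {V S : Type*} [DecidableEq V] [MeasurableSpace S] (i : V) :
    Measurable fun z : (V → S) × S => Function.update z.1 i z.2 := by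
  rw [measurable_pi_iff]
  intro j
  by_cases h : j = i
  · subst h; simpa using measurable_snd
  · simp only [Function.update_of_ne h]
    fun_prop

section Mixture

variable {V S : Type*} [Fintype V] [DecidableEq V] [MeasurableSpace S]

instance isProbabilityMeasure_update {b : V → Measure S} [∀ i, IsProbabilityMeasure (b i)] {i : V}
    {p : Measure S} [IsProbabilityMeasure p] (j : V) :
    IsProbabilityMeasure (Function.update b i p j) := by
  by_cases h : j = i
  · subst h; rw [Function.update_self]; infer_instance
  · rw [Function.update_of_ne h]; infer_instance

theorem pi_update_eq_map (b : V → Measure S) [∀ i, IsProbabilityMeasure (b i)] (i : V)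
    (p : Measure S) [IsProbabilityMeasure p] :
    Measure.pi (Function.update b i p) =
      ((Measure.pi b).prod p).map fun z => Function.update z.1 i z.2 := by
  refine Measure.pi_eq fun t ht => ?_
  have hm := measurable_update_prod (S := S) i
  rw [Measure.map_apply hm (MeasurableSet.univ_pi ht)]
  have hpre : (fun z : (V → S) × S => Function.update z.1 i z.2) ⁻¹' Set.univ.pi t =
      (Set.univ.pi (Function.update t i Set.univ)) ×ˢ t i := by
    ext z
    simp only [Set.mem_preimage, Set.mem_pi, Set.mem_univ, true_imp_iff, Set.mem_prod]
    constructor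
    · intro h
      refine ⟨fun j => ?_, by simpa using h i⟩
      by_cases hj : j = i
      · subst hj; simp
      · simpa [Function.update_of_ne hj] using h j
    · rintro ⟨h1, h2⟩ j
      by_cases hj : j = i
      · subst hj; simpa using h2
      · simpa [Function.update_of_ne hj] using h1 j
  rw [hpre, Measure.prod_prod, Measure.pi_pi, ← Finset.mul_prod_erase _ _ (Finset.mem_univ i),
    ← Finset.mul_prod_erase _ (fun j => Function.update b i p j (t j)) (Finset.mem_univ i)]
  simp only [Function.update_self, measure_univ, one_mul]
  rw [mul_comm]
  congr 1
  refine Finset.prod_congr rfl fun j hj => ?_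
  rw [Function.update_of_ne (Finset.ne_of_mem_erase hj),
    Function.update_of_ne (Finset.ne_of_mem_erase hj)]

/-- By Fubini, the comparison holds on every section along coordinate `i`, and the additive error is
averaged over a probability measure. -/
theorem Indist.pi_update {b : V → Measure S} [∀ i, IsProbabilityMeasure (b i)] (i : V)
    {p p' : Measure S} [IsProbabilityMeasure p] [IsProbabilityMeasure p'] {η : ℝ}
    (h : Indist p p' 0 η) :
    Indist (Measure.pi (Function.update b i p)) (Measure.pi (Function.update b i p')) 0 η := by
  intro E hE
  have hm := measurable_update_prod (S := S) i
  rw [pi_update_eq_map b i p, pi_update_eq_map b i p', Measure.map_apply hm hE,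
    Measure.map_apply hm hE, Measure.prod_apply (hm hE), Measure.prod_apply (hm hE)]
  rw [Real.exp_zero, ENNReal.ofReal_one, one_mul]
  calc _ ≤ ∫⁻ s, (p' (Prod.mk s ⁻¹' ((fun z : (V → S) × S => Function.update z.1 i z.2) ⁻¹' E)) +
        ENNReal.ofReal η) ∂Measure.pi b := by
        refine lintegral_mono fun s => ?_
        have := h _ (measurable_prodMk_left (x := s) (hm hE))
        rwa [Real.exp_zero, ENNReal.ofReal_one, one_mul] at this
    _ = _ := by rw [lintegral_add_right _ measurable_const]; simp

theorem pi_update_withDensity (b : V → Measure S) [∀ i, IsProbabilityMeasure (b i)] (i : V)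
    {h : S → ENNReal} (hh : Measurable h) [IsProbabilityMeasure ((b i).withDensity h)] :
    Measure.pi (Function.update b i ((b i).withDensity h)) =
      (Measure.pi b).withDensity fun s => h (s i) := by
  apply Measure.pi_eq
  intro t ht
  rw [withDensity_apply _ (MeasurableSet.univ_pi ht), Measure.restrict_pi_pi,
    ← Finset.prod_erase_mul _ _ (Finset.mem_univ i), Function.update_self,
    withDensity_apply _ (ht i)]
  have h1 := lintegral_map (μ := Measure.pi fun j => (b j).restrict (t j)) hh
    (measurable_pi_apply i)
  -- The restricted factors are not probability measures: the `i`-th marginal carries the masses of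
  -- the others, which are the remaining factors of the product.
  have h2 := Measure.pi_map_eval (α := fun _ : V => S) (μ := fun j => (b j).restrict (t j)) i
  rw [← h1, show (fun s : V → S => s i) = Function.eval i from rfl, h2, lintegral_smul_measure, smul_eq_mul]
  congr 1
  refine Finset.prod_congr rfl fun j hj => ?_
  rw [Measure.restrict_apply_univ, Function.update_of_ne (Finset.ne_of_mem_erase hj)]

/-- The law on `V → S` which draws all coordinates independently, coordinate `j` from `b j`,
except that with probability `q i` the `i`-th coordinate is drawn from `p i` instead. -/
noncomputable def mixtureLaw (b : V → Measure S) (q : V → ℝ) (p : V → Measure S) :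
    Measure (V → S) :=
  ∑ i, ENNReal.ofReal (q i) • Measure.pi (Function.update b i (p i)) +
    ENNReal.ofReal (1 - ∑ i, q i) • Measure.pi b

theorem mixtureLaw_apply (b : V → Measure S) (q : V → ℝ) (p : V → Measure S) (E : Set (V → S)) :
    mixtureLaw b q p E = ∑ i, ENNReal.ofReal (q i) * Measure.pi (Function.update b i (p i)) E +
      ENNReal.ofReal (1 - ∑ i, q i) * Measure.pi b E := by
  simp [mixtureLaw]

variable {b : V → Measure S} [∀ i, IsProbabilityMeasure (b i)] {q : V → ℝ}

theorem Indist.mixtureLaw (hq : ∀ i, 0 ≤ q i) (hq1 : ∑ i, q i ≤ 1) {p p' : V → Measure S}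
    [∀ i, IsProbabilityMeasure (p i)] [∀ i, IsProbabilityMeasure (p' i)] {η : ℝ}
    (h : ∀ i, Indist (p i) (p' i) 0 η) : Indist (mixtureLaw b q p) (mixtureLaw b q p') 0 η := by
  intro E hE
  rw [mixtureLaw_apply, mixtureLaw_apply, Real.exp_zero, ENNReal.ofReal_one, one_mul]
  have hs : ∑ i, ENNReal.ofReal (q i) * ENNReal.ofReal η ≤ ENNReal.ofReal η := by
    rw [← Finset.sum_mul, ← ENNReal.ofReal_sum_of_nonneg fun i _ => hq i]
    exact mul_le_of_le_one_left' (by simpa using hq1)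
  have h1 : ∀ i, Measure.pi (Function.update b i (p i)) E ≤
      Measure.pi (Function.update b i (p' i)) E + ENNReal.ofReal η := fun i => by
    simpa using (h i).pi_update (b := b) i E hE
  calc _ ≤ ∑ i, ENNReal.ofReal (q i) * (Measure.pi (Function.update b i (p' i)) E +
        ENNReal.ofReal η) + ENNReal.ofReal (1 - ∑ i, q i) * Measure.pi b E := by
        gcongr with i; exact h1 i
    _ = (∑ i, ENNReal.ofReal (q i) * Measure.pi (Function.update b i (p' i)) E +
        ENNReal.ofReal (1 - ∑ i, q i) * Measure.pi b E) +
        ∑ i, ENNReal.ofReal (q i) * ENNReal.ofReal η := by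
        simp only [mul_add, Finset.sum_add_distrib]; ring
    _ ≤ _ := by gcongr

theorem mixtureLaw_withDensity (hq : ∀ i, 0 ≤ q i) (hq1 : ∑ i, q i ≤ 1) {f : V → S → ℝ}
    (hf : ∀ i, Measurable (f i)) (hf0 : ∀ i s, 0 ≤ f i s)
    [∀ i, IsProbabilityMeasure ((b i).withDensity fun s => ENNReal.ofReal (f i s))] :
    mixtureLaw b q (fun i => (b i).withDensity fun s => ENNReal.ofReal (f i s)) =
      (Measure.pi b).withDensity fun s => ENNReal.ofReal (mixtureRatio q f .univ s) := by
  have hd : ∀ s : V → S, ENNReal.ofReal (mixtureRatio q f .univ s) =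
      ∑ i, ENNReal.ofReal (q i) * ENNReal.ofReal (f i (s i)) +
        ENNReal.ofReal (1 - ∑ i, q i) := by
    intro s
    simp only [← ENNReal.ofReal_mul (hq _)]
    rw [← ENNReal.ofReal_sum_of_nonneg fun i _ => mul_nonneg (hq i) (hf0 i _),
      ← ENNReal.ofReal_add (Finset.sum_nonneg fun i _ => mul_nonneg (hq i) (hf0 i _))
        (by linarith), mixtureRatio]
    congr 1
    simp only [mul_sub, Finset.sum_sub_distrib, mul_one]
    ring
  ext E hE
  rw [mixtureLaw_apply, withDensity_apply _ hE]
  simp only [hd]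
  rw [lintegral_add_right _ measurable_const, lintegral_finsetSum]
  · congr 1
    · refine Finset.sum_congr rfl fun i _ => ?_
      rw [pi_update_withDensity b i (h := fun s => ENNReal.ofReal (f i s)) (by have := hf i; fun_prop),
        withDensity_apply _ hE, lintegral_const_mul _ (by have := hf i; fun_prop)]
    · simp
  · intro i _
    have := hf i
    fun_prop

theorem indist_mixtureLaw {f g : V → S → ℝ} (hf : ∀ i, Measurable (f i))
    (hg : ∀ i, Measurable (g i))
    [∀ i, IsProbabilityMeasure ((b i).withDensity fun s => ENNReal.ofReal (f i s))]
    [∀ i, IsProbabilityMeasure ((b i).withDensity fun s => ENNReal.ofReal (g i s))]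
    {c a : ℝ} (hc : 1 ≤ c) (ha : 0 < a)
    (h : ∀ i s, CloseRatios c a (f i s) (g i s)) (hq : ∀ i, 0 ≤ q i) (hq1 : ∑ i, q i ≤ 1)
    {Q δ : ℝ} (hQ : ∑ i, q i ^ 2 ≤ Q) (hQ0 : 0 < Q) (hδ : 0 < δ) (hδ1 : δ < 1) :
    Indist (mixtureLaw b q fun i => (b i).withDensity fun s => ENNReal.ofReal (f i s))
      (mixtureLaw b q fun i => (b i).withDensity fun s => ENNReal.ofReal (g i s))
      (a ^ 2 / 2 * Q + a * Real.sqrt (2 * Real.log (1 / δ) * Q)) δ := by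
  have hc0 : 0 < 1 / c := by have : 0 < c := by linarith
                             positivity
  have one : ∀ (f : V → S → ℝ), (∀ i, Measurable (f i)) → (∀ i s, 0 ≤ f i s) →
      (∀ i, IsProbabilityMeasure ((b i).withDensity fun s => ENNReal.ofReal (f i s))) →
      ∀ i, ∫ s, f i s ∂b i = 1 := by
    intro f hf hf0 hp i
    have := (hp i).measure_univ
    rw [withDensity_apply _ MeasurableSet.univ, Measure.restrict_univ] at this
    rw [integral_eq_lintegral_of_nonneg_ae (ae_of_all _ (hf0 i)) (hf i).aestronglyMeasurable, this]
    simp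
  have hf0 : ∀ i s, 0 ≤ f i s := fun i s => hc0.le.trans (h i s).left_ge
  have hg0 : ∀ i s, 0 ≤ g i s := fun i s => hc0.le.trans (h i s).right_ge
  rw [mixtureLaw_withDensity hq hq1 hf hf0, mixtureLaw_withDensity hq hq1 hg hg0]
  exact indist_mixture hf hg (one f hf hf0 inferInstance) (one g hg hg0 inferInstance) hc ha h hq
    hq1 hQ hQ0 hδ hδ1

end Mixture

/-! ### Densities with two-sided bounds from privacy of the randomizer. -/

section Density

variable {S : Type*} [MeasurableSpace S]

theorem Indist.apply_le_mul {μ ν : Measure S} {ε : ℝ} (h : Indist μ ν ε 0) {E : Set S}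
    (hE : MeasurableSet E) : μ E ≤ ENNReal.ofReal (Real.exp ε) * ν E := by
  simpa using h E hE

theorem Indist.absolutelyContinuous {μ ν : Measure S} {ε : ℝ} (h : Indist μ ν ε 0) : μ ≪ ν :=
  Measure.AbsolutelyContinuous.mk fun E hE h0 => by
    have := h.apply_le_mul hE
    rw [h0, mul_zero] at this
    exact le_antisymm this zero_le

theorem ae_le_of_indist_withDensity {b : Measure S} [IsProbabilityMeasure b] {R R' : S → ENNReal}
    (hR : Measurable R) (hR' : Measurable R') {ε : ℝ}
    (h : Indist (b.withDensity R) (b.withDensity R') ε 0) :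
    ∀ᵐ s ∂b, R s ≤ ENNReal.ofReal (Real.exp ε) * R' s := by
  refine ae_le_of_forall_setLIntegral_le_of_sigmaFinite hR fun E hE _ => ?_
  have := h.apply_le_mul hE
  rwa [withDensity_apply _ hE, withDensity_apply _ hE, ← lintegral_const_mul _ hR'] at this

/-- The direct comparison of `p` with `p'` matters: closeness to `b` alone would bound `|f - g|`
only by `e^ε - e^(-ε)`, whereas `f ≤ e^ε g` and `f ≤ e^ε` together give `f - g ≤ e^ε - 1`. -/
theorem exists_closeRatios_of_indist {b p p' : Measure S} [IsProbabilityMeasure b]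
    [IsProbabilityMeasure p] [IsProbabilityMeasure p'] {ε : ℝ} (hε : 0 ≤ ε)
    (h1 : Indist p b ε 0) (h2 : Indist b p ε 0) (h3 : Indist p' b ε 0) (h4 : Indist b p' ε 0)
    (h5 : Indist p p' ε 0) (h6 : Indist p' p ε 0) :
    ∃ f g : S → ℝ, Measurable f ∧ Measurable g ∧
      (∀ s, CloseRatios (Real.exp ε) (Real.exp ε * (Real.exp ε - 1)) (f s) (g s)) ∧
      p = b.withDensity (fun s => ENNReal.ofReal (f s)) ∧
      p' = b.withDensity (fun s => ENNReal.ofReal (g s)) := by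
  set R := p.rnDeriv b
  set R' := p'.rnDeriv b
  have hR : Measurable R := Measure.measurable_rnDeriv _ _
  have hR' : Measurable R' := Measure.measurable_rnDeriv _ _
  have ep : b.withDensity R = p := Measure.withDensity_rnDeriv_eq _ _ h1.absolutelyContinuous
  have ep' : b.withDensity R' = p' := Measure.withDensity_rnDeriv_eq _ _ h3.absolutelyContinuous
  have eb : b.withDensity (fun _ => 1) = b := withDensity_one
  have he : 1 ≤ Real.exp ε := Real.one_le_exp hε
  have hae : ∀ᵐ s ∂b, (R s ≠ ⊤ ∧ R' s ≠ ⊤) ∧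
      CloseRatios (Real.exp ε) (Real.exp ε * (Real.exp ε - 1)) (R s).toReal (R' s).toReal := by
    have a1 := ae_le_of_indist_withDensity hR measurable_const (by rwa [ep, eb])
    have a2 := ae_le_of_indist_withDensity measurable_const hR (by rwa [ep, eb])
    have a3 := ae_le_of_indist_withDensity hR' measurable_const (by rwa [ep', eb])
    have a4 := ae_le_of_indist_withDensity measurable_const hR' (by rwa [ep', eb])
    have a5 := ae_le_of_indist_withDensity hR hR' (by rwa [ep, ep'])
    have a6 := ae_le_of_indist_withDensity hR' hR (by rwa [ep, ep'])
    filter_upwards [a1, a2, a3, a4, a5, a6, Measure.rnDeriv_lt_top p b, Measure.rnDeriv_lt_top p' b]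
      with s b1 b2 b3 b4 b5 b6 t1 t2
    refine ⟨⟨t1.ne, t2.ne⟩, ?_⟩
    change R s < ⊤ at t1
    change R' s < ⊤ at t2
    have conv : ∀ x y : ENNReal, y ≠ ⊤ → x ≤ ENNReal.ofReal (Real.exp ε) * y →
        x.toReal ≤ Real.exp ε * y.toReal := by
      intro x y hy hxy
      have := ENNReal.toReal_mono (ENNReal.mul_ne_top ENNReal.ofReal_ne_top hy) hxy
      rwa [ENNReal.toReal_mul, ENNReal.toReal_ofReal (Real.exp_pos _).le] at this
    have c1 := conv _ _ ENNReal.one_ne_top b1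
    have c2 := conv _ _ t1.ne b2
    have c3 := conv _ _ ENNReal.one_ne_top b3
    have c4 := conv _ _ t2.ne b4
    have c5 := conv _ _ t2.ne b5
    have c6 := conv _ _ t1.ne b6
    rw [ENNReal.toReal_one] at c1 c2 c3 c4
    set x := (R s).toReal
    set y := (R' s).toReal
    set e := Real.exp ε
    have e0 : 0 < e := by linarith
    have x0 : 0 ≤ x := ENNReal.toReal_nonneg
    have y0 : 0 ≤ y := ENNReal.toReal_nonneg
    refine ⟨by rw [div_le_iff₀ e0]; linarith, by rw [div_le_iff₀ e0]; linarith, by linarith,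
      by linarith, ?_, ?_, ?_⟩ <;> refine mul_le_mul_of_nonneg_left ?_ e0.le <;> rw [abs_le] <;>
      constructor
    · nlinarith
    · linarith
    · nlinarith
    · linarith
    · rcases le_total x 1 with h | h <;> nlinarith
    · rcases le_total y 1 with h | h <;> nlinarith
  obtain ⟨N, hN, hNm, hN0⟩ := exists_measurable_superset_of_null (ae_iff.mp hae)
  have hgood : ∀ s ∉ N, (R s ≠ ⊤ ∧ R' s ≠ ⊤) ∧
      CloseRatios (Real.exp ε) (Real.exp ε * (Real.exp ε - 1)) (R s).toReal (R' s).toReal := by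
    intro s hs
    by_contra hc
    exact hs (hN hc)
  classical
  have hae' : ∀ᵐ s ∂b, s ∉ N := by rw [ae_iff]; simpa using hN0
  -- On the exceptional null set both densities are reset to `1`, so that the bounds hold
  -- everywhere.
  refine ⟨N.piecewise (fun _ => 1) fun s => (R s).toReal,
    N.piecewise (fun _ => 1) fun s => (R' s).toReal,
    Measurable.piecewise hNm measurable_const hR.ennreal_toReal,
    Measurable.piecewise hNm measurable_const hR'.ennreal_toReal, fun s => ?_, ?_, ?_⟩
  · by_cases hs : s ∈ N
    · simp only [Set.piecewise_eq_of_mem _ _ _ hs]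
      refine ⟨?_, ?_, he, he, ?_, ?_, ?_⟩
      any_goals (rw [div_le_one (by linarith)]; exact he)
      all_goals simp only [sub_self, abs_zero, mul_zero]
      all_goals nlinarith
    · simp only [Set.piecewise_eq_of_notMem _ _ _ hs]
      exact (hgood s hs).2
  · rw [← ep]
    refine withDensity_congr_ae ?_
    filter_upwards [hae'] with s hs
    rw [Set.piecewise_eq_of_notMem _ _ _ hs, ENNReal.ofReal_toReal (hgood s hs).1.1]
  · rw [← ep']
    refine withDensity_congr_ae ?_
    filter_upwards [hae'] with s hs
    rw [Set.piecewise_eq_of_notMem _ _ _ hs, ENNReal.ofReal_toReal (hgood s hs).1.2]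

/-- Clipping the density of `p` with respect to `b` to `[e^{-ε}, e^ε]` moves every event by at
most `δ₀`. -/
theorem exists_clipped_density {b p : Measure S} [IsProbabilityMeasure b]
    [IsProbabilityMeasure p] {ε δ₀ : ℝ} (hε : 0 ≤ ε) (h1 : Indist p b ε δ₀)
    (h2 : Indist b p ε δ₀) :
    ∃ h : S → ℝ, Measurable h ∧ (∀ s, 1 / Real.exp ε ≤ h s ∧ h s ≤ Real.exp ε) ∧
      ∀ E, MeasurableSet E →
        p E ≤ b.withDensity (fun s => ENNReal.ofReal (h s)) E + ENNReal.ofReal δ₀ ∧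
        b.withDensity (fun s => ENNReal.ofReal (h s)) E ≤ p E + ENNReal.ofReal δ₀ := by
  set R : S → ℝ := fun s => (p.rnDeriv b s).toReal with hRdef
  have hR : Measurable R := (Measure.measurable_rnDeriv _ _).ennreal_toReal
  have he : 1 ≤ Real.exp ε := Real.one_le_exp hε
  set e := Real.exp ε with hedef
  have e0 : 0 < e := by linarith
  have he' : 1 / e ≤ e := by rw [div_le_iff₀ e0]; nlinarith
  set H : S → ℝ := fun s => max (1 / e) (min e (R s)) with hHdef
  have hH : Measurable H := by fun_prop
  have hac : b.withDensity (fun s => ENNReal.ofReal (R s)) = b.withDensity (p.rnDeriv b) := by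
    refine withDensity_congr_ae ?_
    filter_upwards [Measure.rnDeriv_lt_top p b] with s hs
    rw [hRdef, ENNReal.ofReal_toReal hs.ne]
  have hdec : p = p.singularPart b + b.withDensity (fun s => ENNReal.ofReal (R s)) := by
    rw [hac]; exact p.haveLebesgueDecomposition_add b
  have hRp : ∀ E, MeasurableSet E → ∫⁻ s in E, ENNReal.ofReal (R s) ∂b ≤ p E := by
    intro E hE
    rw [← withDensity_apply _ hE]
    conv_rhs => rw [hdec]
    exact Measure.le_add_left le_rfl E
  obtain ⟨N, hNm, hN1, hN2⟩ := p.mutuallySingular_singularPart b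
  refine ⟨H, hH, fun s => ⟨le_max_left _ _, max_le he' (min_le_left _ _)⟩, fun E hE => ?_⟩
  rw [withDensity_apply _ hE]
  constructor
  -- `W` carries the singular part of `p` and the part of the density that is cut down. There `H =
  -- e` outside a `b`-null set, so `h1` applies directly; off `W` one has `R ≤ H`.
  · set W := Nᶜ ∪ {s | e < R s}
    have hW : MeasurableSet W := hNm.compl.union (measurableSet_lt measurable_const hR)
    have s1 : p (E ∩ W) ≤ ∫⁻ s in E ∩ W, ENNReal.ofReal (H s) ∂b + ENNReal.ofReal δ₀ := by
      refine (h1 _ (hE.inter hW)).trans ?_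
      gcongr
      rw [← setLIntegral_const]
      refine setLIntegral_mono_ae (by fun_prop) ?_
      have : ∀ᵐ s ∂b, s ∉ Nᶜ := measure_eq_zero_iff_ae_notMem.mp hN2
      filter_upwards [this] with s hs hsW
      have hs' : e < R s := by
        rcases hsW.2 with h | h
        · exact absurd h hs
        · exact h
      apply ENNReal.ofReal_le_ofReal
      rw [hHdef]
      simp only
      rw [min_eq_left hs'.le]
      exact le_max_right _ _
    have s2 : p (E \ W) ≤ ∫⁻ s in E \ W, ENNReal.ofReal (H s) ∂b := by
      rw [hdec, Measure.add_apply]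
      have z : p.singularPart b (E \ W) = 0 := by
        refine measure_mono_null ?_ hN1
        intro s hs
        by_contra h
        exact hs.2 (Or.inl h)
      rw [z, zero_add, withDensity_apply _ (hE.diff hW)]
      refine setLIntegral_mono (by fun_prop) fun s hs => ?_
      have hs' : R s ≤ e := by
        by_contra h
        exact hs.2 (Or.inr (not_le.mp h))
      apply ENNReal.ofReal_le_ofReal
      rw [hHdef]
      simp only
      rw [min_eq_right hs']
      exact le_max_right _ _
    rw [← measure_inter_add_sdiff E hW, ← lintegral_inter_add_sdiff _ E hW]
    calc _ ≤ _ := add_le_add s1 s2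
      _ = _ := by ring
  -- The density is raised only on `W`, where `H = 1 / e` and `h2` divided by `e` applies.
  · set W := {s | R s < 1 / e}
    have hW : MeasurableSet W := measurableSet_lt hR measurable_const
    have s1 : ∫⁻ s in E ∩ W, ENNReal.ofReal (H s) ∂b ≤ p (E ∩ W) + ENNReal.ofReal δ₀ := by
      calc ∫⁻ s in E ∩ W, ENNReal.ofReal (H s) ∂b
          ≤ ∫⁻ s in E ∩ W, ENNReal.ofReal (1 / e) ∂b := by
            refine setLIntegral_mono measurable_const fun s hs => ?_
            apply ENNReal.ofReal_le_ofReal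
            have : R s < 1 / e := hs.2
            exact max_le le_rfl ((min_le_right _ _).trans this.le)
        _ = ENNReal.ofReal (1 / e) * b (E ∩ W) := setLIntegral_const _ _
        _ ≤ ENNReal.ofReal (1 / e) * (ENNReal.ofReal e * p (E ∩ W) + ENNReal.ofReal δ₀) := by
            gcongr; exact h2 _ (hE.inter hW)
        _ ≤ _ := by
            rw [mul_add, ← mul_assoc, ← ENNReal.ofReal_mul (by positivity),
              one_div_mul_cancel e0.ne', ENNReal.ofReal_one, one_mul]
            gcongr
            refine mul_le_of_le_one_left' ?_
            rw [ENNReal.ofReal_le_one, div_le_one e0]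
            exact he
    have s2 : ∫⁻ s in E \ W, ENNReal.ofReal (H s) ∂b ≤ p (E \ W) := by
      refine le_trans (setLIntegral_mono (by fun_prop) fun s hs => ?_) (hRp _ (hE.diff hW))
      apply ENNReal.ofReal_le_ofReal
      have hs' : 1 / e ≤ R s := not_lt.mp hs.2
      exact max_le hs' (min_le_right _ _)
    rw [← measure_inter_add_sdiff E hW, ← lintegral_inter_add_sdiff _ E hW]
    calc _ ≤ _ := add_le_add s1 s2
      _ = _ := by ring

/-- A measure that is `(ε, δ₀)`-close to `b` is `2 δ₀`-close in total variation to a measure whose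
density with respect to `b` lies in `[e^{-3ε/2}, e^{3ε/2}]`. -/
theorem exists_bounded_density {b p : Measure S} [IsProbabilityMeasure b]
    [IsProbabilityMeasure p] {ε δ₀ : ℝ} (hε : 0 ≤ ε) (hδ₀ : 0 ≤ δ₀)
    (hδ : δ₀ ≤ (1 - Real.exp (-ε)) / 8) (h1 : Indist p b ε δ₀)
    (h2 : Indist b p ε δ₀) :
    ∃ f : S → ℝ, Measurable f ∧
      (∀ s, 1 / Real.exp (3 / 2 * ε) ≤ f s ∧ f s ≤ Real.exp (3 / 2 * ε)) ∧
      IsProbabilityMeasure (b.withDensity fun s => ENNReal.ofReal (f s)) ∧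
      Indist p (b.withDensity fun s => ENNReal.ofReal (f s)) 0 (2 * δ₀) ∧
      Indist (b.withDensity fun s => ENNReal.ofReal (f s)) p 0 (2 * δ₀) := by
  obtain ⟨h, hm, hb, hE⟩ := exists_clipped_density hε h1 h2
  set ρ := b.withDensity fun s => ENNReal.ofReal (h s) with hρ
  have hfin : ρ Set.univ ≠ ⊤ := ne_top_of_le_ne_top (by simp) (hE _ MeasurableSet.univ).2
  set m := (ρ Set.univ).toReal with hmdef
  have em : ρ Set.univ = ENNReal.ofReal m := (ENNReal.ofReal_toReal hfin).symm
  have m1 : m ≤ 1 + δ₀ := by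
    have := (hE _ MeasurableSet.univ).2
    rw [measure_univ (μ := p), em, ← ENNReal.ofReal_one, ← ENNReal.ofReal_add zero_le_one hδ₀,
      ENNReal.ofReal_le_ofReal_iff (by linarith)] at this
    exact this
  have m2 : 1 - δ₀ ≤ m := by
    have := (hE _ MeasurableSet.univ).1
    rw [measure_univ, em, ← ENNReal.ofReal_one, ← ENNReal.ofReal_add ENNReal.toReal_nonneg hδ₀,
      ENNReal.ofReal_le_ofReal_iff (add_nonneg ENNReal.toReal_nonneg hδ₀)] at this
    linarith
  -- The clipped mass `m` is within `δ₀` of `1`, and `hδ` puts it in `[y, 1 / y]`. Normalising thus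
  -- costs a factor `e^(ε/2)` in the density bounds and a second `δ₀` in total variation.
  set y := Real.exp (-(ε / 2)) with hy
  have hy0 : 0 < y := Real.exp_pos _
  have hy1 : y ≤ 1 := by rw [hy, Real.exp_le_one_iff]; linarith
  have hyy : Real.exp (-ε) = y ^ 2 := by rw [hy, ← Real.exp_nat_mul]; congr 1; push_cast; ring
  rw [hyy] at hδ
  have m3 : y ≤ m := by nlinarith
  have m4 : m * y ≤ 1 := by nlinarith
  have m0 : 0 < m := hy0.trans_le m3
  have ex : Real.exp ε = 1 / y ^ 2 := by rw [← hyy, Real.exp_neg]; simp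
  have ex3 : Real.exp (3 / 2 * ε) = 1 / y ^ 3 := by
    rw [hy, ← Real.exp_nat_mul, one_div, ← Real.exp_neg]; congr 1; push_cast; ring
  have hfe : (b.withDensity fun s => ENNReal.ofReal (h s / m)) = ENNReal.ofReal (1 / m) • ρ := by
    rw [hρ, ← withDensity_smul _ (by fun_prop)]
    congr 1
    ext s
    rw [Pi.smul_apply, smul_eq_mul, ← ENNReal.ofReal_mul (by positivity)]
    congr 1; ring
  have hprob : IsProbabilityMeasure (b.withDensity fun s => ENNReal.ofReal (h s / m)) := by
    constructor
    rw [hfe, Measure.smul_apply, em, smul_eq_mul, ← ENNReal.ofReal_mul (by positivity),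
      one_div_mul_cancel m0.ne', ENNReal.ofReal_one]
  have hρE : ∀ E, ρ E = ENNReal.ofReal m * (b.withDensity fun s => ENNReal.ofReal (h s / m)) E := by
    intro E
    rw [hfe, Measure.smul_apply, smul_eq_mul, ← mul_assoc, ← ENNReal.ofReal_mul m0.le,
      mul_one_div_cancel m0.ne', ENNReal.ofReal_one, one_mul]
  refine ⟨fun s => h s / m, by fun_prop, fun s => ?_, hprob, fun E hEm => ?_, fun E hEm => ?_⟩
  · rw [ex3]
    obtain ⟨b1, b2⟩ := hb s
    rw [ex] at b1 b2
    constructor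
    · rw [le_div_iff₀ m0]
      refine le_trans ?_ b1
      simp only [one_div_one_div]
      nlinarith [pow_pos hy0 2]
    · rw [div_le_iff₀ m0]
      refine b2.trans ?_
      rw [one_div_mul_eq_div, div_le_div_iff₀ (by positivity) (by positivity)]
      nlinarith [pow_pos hy0 2]
  · have k := (hE E hEm).1
    rw [hρE] at k
    rw [Real.exp_zero, ENNReal.ofReal_one, one_mul]
    refine k.trans ?_
    set w := (b.withDensity fun s => ENNReal.ofReal (h s / m)) E
    have w1 : w ≤ 1 := prob_le_one
    calc ENNReal.ofReal m * w + ENNReal.ofReal δ₀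
        ≤ ENNReal.ofReal (1 + δ₀) * w + ENNReal.ofReal δ₀ := by gcongr
      _ = w + ENNReal.ofReal δ₀ * w + ENNReal.ofReal δ₀ := by
          rw [ENNReal.ofReal_add zero_le_one hδ₀, ENNReal.ofReal_one, add_mul, one_mul]
      _ ≤ w + ENNReal.ofReal δ₀ * 1 + ENNReal.ofReal δ₀ := by gcongr
      _ = _ := by rw [mul_one, two_mul, ENNReal.ofReal_add hδ₀ hδ₀, add_assoc]
  · have k := (hE E hEm).2
    rw [hρE] at k
    rw [Real.exp_zero, ENNReal.ofReal_one, one_mul]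
    set w := (b.withDensity fun s => ENNReal.ofReal (h s / m)) E
    have w1 : w ≤ 1 := prob_le_one
    calc w = ENNReal.ofReal 1 * w := by simp
      _ ≤ ENNReal.ofReal (m + δ₀) * w := by gcongr; linarith
      _ = ENNReal.ofReal m * w + ENNReal.ofReal δ₀ * w := by
          rw [ENNReal.ofReal_add m0.le hδ₀, add_mul]
      _ ≤ (p E + ENNReal.ofReal δ₀) + ENNReal.ofReal δ₀ * 1 := by gcongr
      _ = _ := by rw [mul_one, two_mul, ENNReal.ofReal_add hδ₀ hδ₀, add_assoc]

end Density

/-! ### Comparison of mixtures built from pure and approximate randomizers. -/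

section Mixture

variable {V S : Type*} [Fintype V] [DecidableEq V] [MeasurableSpace S]

theorem indist_mixtureLaw_of_pure {b : V → Measure S} [∀ i, IsProbabilityMeasure (b i)]
    {q : V → ℝ} {p p' : Measure S} [IsProbabilityMeasure p] [IsProbabilityMeasure p'] {ε : ℝ}
    (hε : 0 < ε) (h1 : ∀ i, Indist p (b i) ε 0) (h2 : ∀ i, Indist (b i) p ε 0)
    (h3 : ∀ i, Indist p' (b i) ε 0) (h4 : ∀ i, Indist (b i) p' ε 0)
    (h5 : Indist p p' ε 0) (h6 : Indist p' p ε 0)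
    (hq : ∀ i, 0 ≤ q i) (hq1 : ∑ i, q i ≤ 1)
    {Q δ : ℝ} (hQ : ∑ i, q i ^ 2 ≤ Q) (hQ0 : 0 < Q) (hδ : 0 < δ) (hδ1 : δ < 1) :
    Indist (mixtureLaw b q fun _ => p) (mixtureLaw b q fun _ => p') (singleEps ε δ Q) δ := by
  choose f g hf hg hfg ef eg using fun i =>
    exists_closeRatios_of_indist hε.le (h1 i) (h2 i) (h3 i) (h4 i) h5 h6
  have hp : ∀ i, IsProbabilityMeasure ((b i).withDensity fun s => ENNReal.ofReal (f i s)) :=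
    fun i => by rw [← ef i]; infer_instance
  have hp' : ∀ i, IsProbabilityMeasure ((b i).withDensity fun s => ENNReal.ofReal (g i s)) :=
    fun i => by rw [← eg i]; infer_instance
  have he : 1 < Real.exp ε := Real.one_lt_exp_iff.mpr hε
  have := indist_mixtureLaw (b := b) hf hg he.le (mul_pos (by linarith) (by linarith)) hfg hq hq1 hQ hQ0
    hδ hδ1
  simp only [← ef, ← eg] at this
  refine this.mono (le_of_eq ?_) le_rfl
  rw [singleEps, show Real.exp (2 * ε) = Real.exp ε ^ 2 by rw [← Real.exp_nat_mul]; norm_cast]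
  ring

theorem indist_mixtureLaw_of_approx {b : V → Measure S} [∀ i, IsProbabilityMeasure (b i)]
    {q : V → ℝ} {p p' : Measure S} [IsProbabilityMeasure p] [IsProbabilityMeasure p'] {ε δ₀ : ℝ}
    (hε : 0 < ε) (hδ₀ : 0 ≤ δ₀) (hδ₀' : δ₀ ≤ (1 - Real.exp (-ε)) / 8)
    (h1 : ∀ i, Indist p (b i) ε δ₀) (h2 : ∀ i, Indist (b i) p ε δ₀)
    (h3 : ∀ i, Indist p' (b i) ε δ₀) (h4 : ∀ i, Indist (b i) p' ε δ₀)
    (hq : ∀ i, 0 ≤ q i) (hq1 : ∑ i, q i ≤ 1)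
    {Q δ a ε' : ℝ} (hQ : ∑ i, q i ^ 2 ≤ Q) (hQ0 : 0 < Q) (hδ : 0 < δ) (hδ1 : δ < 1)
    (ha : Real.exp (3 * ε) - 1 ≤ a)
    (hε' : ε' = a ^ 2 / 2 * Q + a * Real.sqrt (2 * Real.log (1 / δ) * Q)) :
    Indist (mixtureLaw b q fun _ => p) (mixtureLaw b q fun _ => p') ε'
      (δ + (Real.exp ε' + 1) * (2 * δ₀)) := by
  choose f hf hfb hp hpf hfp using fun i => exists_bounded_density hε.le hδ₀ hδ₀' (h1 i) (h2 i)
  choose g hg hgb hp' hpg hgp using fun i => exists_bounded_density hε.le hδ₀ hδ₀' (h3 i) (h4 i)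
  set c := Real.exp (3 / 2 * ε) with hc
  have c1 : 1 < c := Real.one_lt_exp_iff.mpr (by linarith)
  have c0 : 0 < c := by linarith
  have cc : c * c = Real.exp (3 * ε) := by rw [hc, ← Real.exp_add]; congr 1; ring
  rw [← cc] at ha
  -- All values of `f` and `g`, and `1`, lie in `[1 / c, c]`, so every deviation is at most `c - 1 /
  -- c`.
  have hca : c * (c - 1 / c) ≤ a := by
    rw [mul_sub, mul_one_div_cancel c0.ne']; exact ha
  have hc1 : 1 / c ≤ 1 := by rw [div_le_one c0]; exact c1.le
  have hclose : ∀ i s, CloseRatios c a (f i s) (g i s) := by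
    intro i s
    obtain ⟨f1, f2⟩ := hfb i s
    obtain ⟨g1, g2⟩ := hgb i s
    refine ⟨f1, g1, f2, g2, ?_, ?_, ?_⟩ <;>
      refine (mul_le_mul_of_nonneg_left ?_ c0.le).trans hca <;> rw [abs_le] <;>
      constructor <;> linarith
  have key := indist_mixtureLaw (b := b) hf hg c1.le (by nlinarith) hclose hq hq1 hQ hQ0 hδ hδ1
  rw [← hε'] at key
  -- Replacing `p` costs `2 * δ₀`; replacing `p'` costs `exp ε' * (2 * δ₀)`, being on the side that
  -- is multiplied.
  have k1 := (Indist.mixtureLaw (b := b) hq hq1 hpf).trans_zero_left hδ.le (by linarith) key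
  have k2 := k1.trans_zero_right (by linarith) (by linarith) (Indist.mixtureLaw (b := b) hq hq1 hgp)
  exact k2.mono le_rfl (by linarith)

end Mixture

/-! ### Resampling, the random walk, and isolating the report of one user. -/

/-- Resampling coordinate `i` of a product distribution on `ι → α` from the weights `v`. -/
theorem sum_prod_erase_mul {ι α : Type*} [Fintype ι] [DecidableEq ι] [Fintype α]
    (w : ι → α → ℝ) (i : ι) (hw : ∑ a, w i a = 1) (v : α → ℝ) (Ψ : (ι → α) → ℝ) :
    ∑ c : ι → α, v (c i) * (∏ j ∈ Finset.univ.erase i, w j (c j)) * Ψ c =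
      ∑ c : ι → α, (∏ j, w j (c j)) * ∑ o, v o * Ψ (Function.update c i o) := by
  simp only [Finset.mul_sum]
  rw [← Fintype.sum_prod_type' (f := fun (c : ι → α) o =>
    (∏ j, w j (c j)) * (v o * Ψ (Function.update c i o)))]
  -- This involution exchanges coordinate `i` with the spare value; the spare value then carries the
  -- weights `w i`, which sum to one.
  let e : (ι → α) × α → (ι → α) × α := fun z => (Function.update z.1 i z.2, z.1 i)
  have he : Function.Involutive e := fun z => by simp [e]
  rw [← Equiv.sum_comp he.toPerm, Fintype.sum_prod_type]
  refine Finset.sum_congr rfl fun c _ => ?_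
  have : ∀ o, (∏ j, w j (Function.update c i o j)) =
      w i o * ∏ j ∈ Finset.univ.erase i, w j (c j) := by
    intro o
    rw [← Finset.mul_prod_erase _ _ (Finset.mem_univ i), Function.update_self]
    congr 1
    refine Finset.prod_congr rfl fun j hj => ?_
    rw [Function.update_of_ne (Finset.ne_of_mem_erase hj)]
  simp only [Function.Involutive.coe_toPerm, e, this, Function.update_idem, Function.update_eq_self]
  rw [← one_mul (v (c i) * _ * _), ← hw, Finset.sum_mul]
  refine Finset.sum_congr rfl fun o _ => ?_
  ring

theorem sum_prod_mul_update {ι α : Type*} [Fintype ι] [DecidableEq ι] [Fintype α]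
    (w : ι → α → ℝ) (i : ι) (hw : ∑ a, w i a = 1) (Ψ : (ι → α) → ℝ) :
    ∑ c : ι → α, (∏ j, w j (c j)) * ∑ o, w i o * Ψ (Function.update c i o) =
      ∑ c : ι → α, (∏ j, w j (c j)) * Ψ c := by
  rw [← sum_prod_erase_mul w i hw]
  refine Finset.sum_congr rfl fun c _ => ?_
  rw [Finset.mul_prod_erase _ (fun j => w j (c j)) (Finset.mem_univ i)]

section Walk

variable {V : Type*} [Fintype V] (G : SimpleGraph V) [DecidableRel G.Adj]

theorem transitionMatrix_nonneg (i j : V) : 0 ≤ transitionMatrix G i j := by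
  simp only [transitionMatrix, Matrix.of_apply, SimpleGraph.adjMatrix_apply]
  exact div_nonneg (by split_ifs <;> norm_num)
    (Finset.sum_nonneg fun _ _ => by split_ifs <;> norm_num)

variable {G} in
theorem sum_transitionMatrix {k : ℕ} (hk : 0 < k) (hreg : G.IsRegularOfDegree k) (i : V) :
    ∑ j, transitionMatrix G i j = 1 := by
  simp only [transitionMatrix, Matrix.of_apply]
  rw [← Finset.sum_div]
  apply div_self
  have h : ∑ j, G.adjMatrix ℝ i j = G.degree i := by
    rw [← SimpleGraph.card_neighborFinset_eq_degree, SimpleGraph.neighborFinset_eq_filter]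
    simp [SimpleGraph.adjMatrix_apply]
  rw [h, hreg i]
  exact_mod_cast hk.ne'

variable [DecidableEq V]

/-- The reports walk independently, so a sum over intermediate configurations of a product factors
into matrix products. -/
theorem configProb_eq_prod (t : ℕ) (y : V → V) :
    configProb G t y = ∏ j, (transitionMatrix G ^ t) j (y j) := by
  induction t generalizing y with
  | zero =>
    rw [configProb, pow_zero]
    split_ifs with h
    · subst h
      exact (Finset.prod_eq_one fun j _ => Matrix.one_apply_eq j).symm
    · obtain ⟨j, hj⟩ := Function.ne_iff.mp h
      refine (Finset.prod_eq_zero (Finset.mem_univ j) ?_).symm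
      exact Matrix.one_apply_ne fun e => hj e.symm
  | succ t ih =>
    rw [configProb]
    simp only [ih, ← Finset.prod_mul_distrib, pow_succ, Matrix.mul_apply]
    rw [Fintype.prod_sum]

theorem positionDist_apply (t : ℕ) (u i : V) :
    positionDist G t u i = (transitionMatrix G ^ t) u i := by
  rw [positionDist, Matrix.mulVec_single_one, ← Matrix.transpose_pow]
  rfl

theorem positionDist_nonneg (t : ℕ) (u i : V) : 0 ≤ positionDist G t u i := by
  rw [positionDist_apply]
  induction t generalizing i with
  | zero => rw [pow_zero, Matrix.one_apply]; split_ifs <;> norm_num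
  | succ t ih =>
    rw [pow_succ, Matrix.mul_apply]
    exact Finset.sum_nonneg fun l _ => mul_nonneg (ih l) (transitionMatrix_nonneg G l i)

variable {G}

theorem sum_positionDist {k : ℕ} (hk : 0 < k) (hreg : G.IsRegularOfDegree k) (t : ℕ) (u : V) :
    ∑ i, positionDist G t u i = 1 := by
  simp only [positionDist_apply]
  induction t with
  | zero => simp [Matrix.one_apply]
  | succ t ih =>
    simp only [pow_succ, Matrix.mul_apply]
    rw [Finset.sum_comm]
    simp only [← Finset.mul_sum, sum_transitionMatrix hk hreg, mul_one, ih]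

theorem collision_pos {k : ℕ} (hk : 0 < k) (hreg : G.IsRegularOfDegree k) (t : ℕ) (u : V) :
    0 < collision G t u := by
  refine (Finset.sum_nonneg fun i _ => sq_nonneg _).lt_of_ne fun h => ?_
  have h0 := (Finset.sum_eq_zero_iff_of_nonneg fun i _ => sq_nonneg _).mp h.symm
  have h1 := sum_positionDist hk hreg t u
  rw [Finset.sum_eq_zero fun i hi => by simpa using h0 i hi] at h1
  exact zero_ne_one h1

/-- Probability that, ignoring the report of `u`, user `i` submits the given report. -/
noncomputable def pickProbErase (u : V) (y : V → V) (i : V) : Option V → ℝ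
  | none => if (heldReports y i).erase u = ∅ then 1 else 0
  | some j => if j ∈ (heldReports y i).erase u then
      1 / (((heldReports y i).erase u).card : ℝ) else 0

/-- Probability that user `i` submits the report of `u` when it joins her other reports. -/
noncomputable def joinProb (u : V) (y : V → V) (i : V) : ℝ :=
  1 / (((heldReports y i).erase u).card + 1)

theorem joinProb_nonneg (u : V) (y : V → V) (i : V) : 0 ≤ joinProb u y i := by
  unfold joinProb; positivity

theorem joinProb_le_one (u : V) (y : V → V) (i : V) : joinProb u y i ≤ 1 := by
  unfold joinProb
  rw [div_le_one (by positivity)]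
  linarith [Nat.cast_nonneg (α := ℝ) ((heldReports y i).erase u).card]

theorem pickProbErase_nonneg (u : V) (y : V → V) (i : V) (o : Option V) :
    0 ≤ pickProbErase u y i o := by
  cases o <;> simp only [pickProbErase] <;> split_ifs <;> positivity

theorem sum_pickProbErase (u : V) (y : V → V) (i : V) : ∑ o, pickProbErase u y i o = 1 := by
  rw [Fintype.sum_option]
  simp only [pickProbErase]
  rw [Finset.sum_ite_mem, Finset.univ_inter, Finset.sum_const, nsmul_eq_mul]
  split_ifs with h
  · simp [h]
  · rw [zero_add, mul_one_div_cancel]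
    simpa using Finset.nonempty_iff_ne_empty.mp (Finset.nonempty_iff_ne_empty.mpr h)

theorem eq_of_pickProbErase_ne_zero {u : V} {y : V → V} {i j : V}
    (h : pickProbErase u y i (some j) ≠ 0) : y j = i ∧ j ≠ u := by
  simp only [pickProbErase] at h
  split_ifs at h with hj
  · simp only [heldReports, Finset.mem_erase, Finset.mem_filter, Finset.mem_univ, true_and] at hj
    exact ⟨hj.2, hj.1⟩
  · exact absurd rfl h

theorem heldReports_update_self (y : V → V) (u i : V) :
    heldReports (Function.update y u i) i = insert u ((heldReports y i).erase u) := by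
  ext j
  by_cases h : j = u <;> simp [heldReports, h]

theorem heldReports_update_of_ne (y : V → V) {u i j : V} (h : j ≠ i) :
    heldReports (Function.update y u i) j = (heldReports y j).erase u := by
  ext l
  by_cases hl : l = u <;> simp [heldReports, hl, h.symm]

theorem pickProb_update_of_ne (y : V → V) {u i j : V} (h : j ≠ i) (o : Option V) :
    pickProb (Function.update y u i) j o = pickProbErase u y j o := by
  cases o <;> simp only [pickProb, pickProbErase, heldReports_update_of_ne y h]

/-- A uniform pick among `m + 1` reports is a choice of `u` with probability `1 / (m + 1)`, and
otherwise a uniform pick among the other `m`. When `m = 0` the dummy branch has weight zero. -/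
theorem pickProb_update_self (y : V → V) (u i : V) (o : Option V) :
    pickProb (Function.update y u i) i o =
      joinProb u y i * (if o = some u then 1 else 0) +
        (1 - joinProb u y i) * pickProbErase u y i o := by
  have hu : u ∉ (heldReports y i).erase u := by simp
  cases o with
  | none =>
    simp only [pickProb, pickProbErase, heldReports_update_self, joinProb]
    by_cases h : (heldReports y i).erase u = ∅ <;> simp [h]
  | some j =>
    simp only [pickProb, pickProbErase, heldReports_update_self, joinProb,
      Finset.card_insert_of_notMem hu, Option.some.injEq, Finset.mem_insert]
    by_cases hj : j = u
    · subst hj; simp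
    · by_cases hm : j ∈ (heldReports y i).erase u
      · have hc : (0 : ℝ) < ((heldReports y i).erase u).card := by
          exact_mod_cast Finset.card_pos.mpr ⟨j, hm⟩
        simp only [hj, hm, or_true, if_true, if_false]
        push_cast
        field_simp
        ring
      · simp [hj, hm]

/-- Conditioning the protocol on everything but the route of the report of `u`. -/
theorem sum_configProb_mul {k : ℕ} (hk : 0 < k) (hreg : G.IsRegularOfDegree k) (t : ℕ) (u : V)
    (Ψ : (V → Option V) → ℝ) :
    ∑ y, ∑ c : V → Option V, configProb G t y * (∏ i, pickProb y i (c i)) * Ψ c =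
      ∑ y, ∑ c : V → Option V, configProb G t y * (∏ i, pickProbErase u y i (c i)) *
        (∑ i, positionDist G t u i * joinProb u y i * Ψ (Function.update c i (some u)) +
          (1 - ∑ i, positionDist G t u i * joinProb u y i) * Ψ c) := by
  have hinner : ∀ y i, ∑ c : V → Option V,
      (∏ j, pickProb (Function.update y u i) j (c j)) * Ψ c =
      ∑ c : V → Option V, (∏ j, pickProbErase u y j (c j)) *
        (joinProb u y i * Ψ (Function.update c i (some u)) + (1 - joinProb u y i) * Ψ c) := by
    intro y i
    have h1 : ∀ c : V → Option V, (∏ j, pickProb (Function.update y u i) j (c j)) * Ψ c =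
        pickProb (Function.update y u i) i (c i) *
          (∏ j ∈ Finset.univ.erase i, pickProbErase u y j (c j)) * Ψ c := by
      intro c
      rw [← Finset.mul_prod_erase _ _ (Finset.mem_univ i)]
      congr 2
      exact Finset.prod_congr rfl fun j hj => pickProb_update_of_ne y (Finset.ne_of_mem_erase hj) _
    rw [Finset.sum_congr rfl fun c _ => h1 c,
      sum_prod_erase_mul (pickProbErase u y) i (sum_pickProbErase u y i)]
    simp only [pickProb_update_self]
    simp only [add_mul, Finset.sum_add_distrib, mul_assoc, ← Finset.mul_sum, mul_add]
    congr 1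
    · simp
    · simp only [mul_left_comm _ (1 - joinProb u y i), ← Finset.mul_sum]
      rw [sum_prod_mul_update _ i (sum_pickProbErase u y i)]
  simp only [mul_assoc, ← Finset.mul_sum, configProb_eq_prod]
  have hrow : ∑ a, (transitionMatrix G ^ t) u a = 1 := by
    simpa only [positionDist_apply] using sum_positionDist hk hreg t u
  -- The endpoint of `u` is resampled from its own law; `pickProbErase` and `joinProb` do not see
  -- it.
  rw [← sum_prod_mul_update _ u hrow]
  refine Finset.sum_congr rfl fun y _ => ?_
  simp only [hinner]
  congr 1
  simp only [Finset.mul_sum]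
  rw [Finset.sum_comm]
  refine Finset.sum_congr rfl fun c _ => ?_
  simp only [positionDist_apply]
  rw [mul_add, sub_mul, one_mul, Finset.mul_sum, Finset.sum_mul, mul_sub, Finset.mul_sum]
  have : (∏ j, pickProbErase u y j (c j)) * Ψ c =
      ∑ i, (transitionMatrix G ^ t) u i * ((∏ j, pickProbErase u y j (c j)) * Ψ c) := by
    rw [← Finset.sum_mul, hrow, one_mul]
  rw [this, ← Finset.sum_sub_distrib, ← Finset.sum_add_distrib]
  refine Finset.sum_congr rfl fun i _ => ?_
  ring

end Walk

/-! ### Output law of the protocol and reduction to mixtures. -/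

/-- Since `hc` forbids submitting one report twice, different coordinates read different independent
draws. -/
theorem map_option_elim_pi {V S : Type*} [Fintype V] [MeasurableSpace S]
    (μ ν : V → Measure S) [∀ i, IsProbabilityMeasure (μ i)] [∀ i, IsProbabilityMeasure (ν i)]
    (c : V → Option V) (hc : ∀ i j k, c i = some k → c j = some k → i = j) :
    Measure.map (fun (p : (V → S) × (V → S)) (i : V) => (c i).elim (p.2 i) p.1)
      ((Measure.pi μ).prod (Measure.pi ν)) = Measure.pi fun i => (c i).elim (ν i) μ := by
  classical
  have hp : ∀ i, IsProbabilityMeasure ((c i).elim (ν i) μ) := fun i => by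
    cases c i <;> simp only [Option.elim] <;> infer_instance
  refine (Measure.pi_eq fun T hT => ?_).symm
  have hm : Measurable fun (p : (V → S) × (V → S)) (i : V) => (c i).elim (p.2 i) p.1 := by
    rw [measurable_pi_iff]
    intro i
    cases c i <;> simp only [Option.elim] <;> fun_prop
  rw [Measure.map_apply hm (MeasurableSet.univ_pi hT)]
  have hpre : (fun (p : (V → S) × (V → S)) (i : V) => (c i).elim (p.2 i) p.1) ⁻¹' Set.univ.pi T =
      (Set.univ.pi fun j => {s | ∀ i, c i = some j → s ∈ T i}) ×ˢ
        (Set.univ.pi fun i => {s | c i = none → s ∈ T i}) := by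
    ext p
    simp only [Set.mem_preimage, Set.mem_pi, Set.mem_univ, true_imp_iff, Set.mem_prod,
      Set.mem_ofPred_eq]
    constructor
    · intro h
      refine ⟨fun j i hi => by simpa [hi] using h i, fun i hi => by simpa [hi] using h i⟩
    · rintro ⟨h1, h2⟩ i
      cases hi : c i with
      | none => exact h2 i hi
      | some j => exact h1 j i hi
  rw [hpre, Measure.prod_prod, Measure.pi_pi, Measure.pi_pi]
  have h1 : ∀ j, μ j {s | ∀ i, c i = some j → s ∈ T i} =
      ∏ i, if c i = some j then μ j (T i) else 1 := by
    intro j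
    by_cases h : ∃ i, c i = some j
    · obtain ⟨i, hi⟩ := h
      rw [Finset.prod_eq_single i, if_pos hi]
      · congr 1
        ext s
        exact ⟨fun h => h i hi, fun h l hl => by rwa [hc l i j hl hi]⟩
      · intro l _ hl
        rw [if_neg fun h => hl (hc l i j h hi)]
      · simp
    · push Not at h
      rw [Finset.prod_eq_one fun i _ => if_neg (h i)]
      have : {s | ∀ i, c i = some j → s ∈ T i} = Set.univ :=
        Set.eq_univ_of_forall fun s i hi => absurd hi (h i)
      rw [this, measure_univ]
  simp only [h1]
  rw [Finset.prod_comm, ← Finset.prod_mul_distrib]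
  refine Finset.prod_congr rfl fun i _ => ?_
  cases hi : c i with
  | none => simp
  | some j => simp [Finset.prod_ite_eq]

section Protocol

variable {V : Type*} [Fintype V] [DecidableEq V] {G : SimpleGraph V} [DecidableRel G.Adj]
  {D S : Type*} [MeasurableSpace S] {A : D → Measure S} [∀ x, IsProbabilityMeasure (A x)]

theorem configProb_nonneg (t : ℕ) (y : V → V) : 0 ≤ configProb G t y := by
  rw [configProb_eq_prod]
  exact Finset.prod_nonneg fun j _ => by
    rw [← positionDist_apply]; exact positionDist_nonneg G t j _

theorem sum_configProb {k : ℕ} (hk : 0 < k) (hreg : G.IsRegularOfDegree k) (t : ℕ) :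
    ∑ y, configProb G t y = 1 := by
  simp only [configProb_eq_prod]
  rw [← Fintype.prod_sum fun j i => (transitionMatrix G ^ t) j i]
  exact Finset.prod_eq_one fun j _ => by
    simpa only [positionDist_apply] using sum_positionDist hk hreg t j

theorem sum_prod_pickProbErase (u : V) (y : V → V) :
    ∑ c : V → Option V, ∏ i, pickProbErase u y i (c i) = 1 := by
  rw [← Fintype.prod_sum]
  exact Finset.prod_eq_one fun i _ => sum_pickProbErase u y i

/-- Law of the submission of a user who submits the report named by the given option. -/
noncomputable def submissionLaw (A : D → Measure S) (dummy : D) (x : V → D) (o : Option V) :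
    Measure S :=
  A (o.elim dummy x)

theorem pickProb_nonneg (y : V → V) (i : V) (o : Option V) : 0 ≤ pickProb y i o := by
  cases o <;> simp only [pickProb] <;> split_ifs <;> positivity

theorem eq_of_pickProb_ne_zero {y : V → V} {i j : V} (h : pickProb y i (some j) ≠ 0) :
    y j = i := by
  simp only [pickProb] at h
  split_ifs at h with hj
  · simpa [heldReports] using hj
  · exact absurd rfl h

theorem singleProtocol_apply (dummy : D) (t : ℕ) (x : V → D) (E : Set (V → S)) :
    singleProtocol G A dummy t x E = ENNReal.ofReal (∑ y, ∑ c : V → Option V,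
      configProb G t y * (∏ i, pickProb y i (c i)) *
        (Measure.pi (fun i => submissionLaw A dummy x (c i)) E).toReal) := by
  have hw : ∀ y (c : V → Option V), 0 ≤ configProb G t y * ∏ i, pickProb y i (c i) := fun y c =>
    mul_nonneg (configProb_nonneg t y) (Finset.prod_nonneg fun i _ => pickProb_nonneg y i _)
  have hp : ∀ o, IsProbabilityMeasure (submissionLaw A dummy x o) := fun o => by
    unfold submissionLaw; infer_instance
  rw [ENNReal.ofReal_sum_of_nonneg fun y _ => Finset.sum_nonneg fun c _ =>
    mul_nonneg (hw y c) ENNReal.toReal_nonneg, singleProtocol, Measure.finsetSum_apply]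
  refine Finset.sum_congr rfl fun y _ => ?_
  rw [ENNReal.ofReal_sum_of_nonneg fun c _ => mul_nonneg (hw y c) ENNReal.toReal_nonneg,
    Measure.finsetSum_apply]
  refine Finset.sum_congr rfl fun c _ => ?_
  rw [Measure.smul_apply, smul_eq_mul, ENNReal.ofReal_mul (hw y c),
    ENNReal.ofReal_toReal (measure_ne_top _ _)]
  -- Picks that repeat a report have weight zero, because each report has only one holder.
  by_cases h0 : ∏ i, pickProb y i (c i) = 0
  · simp [h0]
  · rw [← ne_eq, Finset.prod_ne_zero_iff] at h0
    rw [map_option_elim_pi (fun j => A (x j)) (fun _ => A dummy) c]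
    · congr 3
      ext1 i
      cases c i <;> rfl
    · intro i j k hi hj
      have h1 := h0 i (Finset.mem_univ i)
      have h2 := h0 j (Finset.mem_univ j)
      rw [hi] at h1
      rw [hj] at h2
      exact (eq_of_pickProb_ne_zero h1).symm.trans (eq_of_pickProb_ne_zero h2)

theorem mixtureLaw_toReal {b : V → Measure S} [∀ i, IsProbabilityMeasure (b i)] {q : V → ℝ}
    (hq : ∀ i, 0 ≤ q i) (hq1 : ∑ i, q i ≤ 1) (p : Measure S) [IsProbabilityMeasure p]
    (E : Set (V → S)) :
    mixtureLaw b q (fun _ => p) E = ENNReal.ofReal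
      (∑ i, q i * (Measure.pi (Function.update b i p) E).toReal +
        (1 - ∑ i, q i) * (Measure.pi b E).toReal) := by
  have hn : ∀ i, 0 ≤ q i * (Measure.pi (Function.update b i p) E).toReal := fun i =>
    mul_nonneg (hq i) ENNReal.toReal_nonneg
  rw [mixtureLaw_apply, ENNReal.ofReal_add (Finset.sum_nonneg fun i _ => hn i)
    (mul_nonneg (by linarith) ENNReal.toReal_nonneg), ENNReal.ofReal_sum_of_nonneg fun i _ => hn i,
    ENNReal.ofReal_mul (by linarith), ENNReal.ofReal_toReal (measure_ne_top _ _)]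
  congr 1
  refine Finset.sum_congr rfl fun i _ => ?_
  rw [ENNReal.ofReal_mul (hq i), ENNReal.ofReal_toReal (measure_ne_top _ _)]

/-- Privacy of the "single" protocol at `u` reduces to that of the mixtures seen once everything
but the route of the report of `u` is fixed. -/
theorem isDPAt_singleProtocol_of_mixtureLaw {k : ℕ} (hk : 0 < k) (hreg : G.IsRegularOfDegree k)
    (dummy : D) (t : ℕ) (u : V) {ε δ : ℝ} (hδ : 0 ≤ δ)
    (h : ∀ (d : V → D) (q : V → ℝ), (∀ i, 0 ≤ q i) → ∑ i, q i ≤ 1 →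
      ∑ i, q i ^ 2 ≤ collision G t u → ∀ d₁ d₂ : D,
      Indist (mixtureLaw (fun i => A (d i)) q fun _ => A d₁)
        (mixtureLaw (fun i => A (d i)) q fun _ => A d₂) ε δ) :
    IsDPAt (singleProtocol G A dummy t) u ε δ := by
  intro x x' hx E hE
  rw [singleProtocol_apply, singleProtocol_apply, sum_configProb_mul hk hreg t u,
    sum_configProb_mul hk hreg t u, ← ENNReal.ofReal_mul (Real.exp_pos _).le]
  have hw : ∀ y (c : V → Option V), 0 ≤ configProb G t y * ∏ i, pickProbErase u y i (c i) :=
    fun y c => mul_nonneg (configProb_nonneg t y)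
      (Finset.prod_nonneg fun i _ => pickProbErase_nonneg u y i _)
  set q : (V → V) → V → ℝ := fun y i => positionDist G t u i * joinProb u y i with hqdef
  have hq0 : ∀ y i, 0 ≤ q y i := fun y i =>
    mul_nonneg (positionDist_nonneg G t u i) (joinProb_nonneg u y i)
  have hqP : ∀ y i, q y i ≤ positionDist G t u i := fun y i =>
    mul_le_of_le_one_right (positionDist_nonneg G t u i) (joinProb_le_one u y i)
  have hq1 : ∀ y, ∑ i, q y i ≤ 1 := fun y =>
    (Finset.sum_le_sum fun i _ => hqP y i).trans (sum_positionDist hk hreg t u).le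
  have hq2 : ∀ y, ∑ i, q y i ^ 2 ≤ collision G t u := fun y =>
    Finset.sum_le_sum fun i _ => pow_le_pow_left₀ (hq0 y i) (hqP y i) 2
  have hup : ∀ (x : V → D) (c : V → Option V) i,
      (fun j => submissionLaw A dummy x (Function.update c i (some u) j)) =
        Function.update (fun j => A ((c j).elim dummy x)) i (A (x u)) := by
    intro x c i
    ext1 j
    by_cases hj : j = i
    · subst hj; simp [submissionLaw]
    · simp [hj, submissionLaw]
  have hnn : ∀ (x : V → D) y (c : V → Option V), 0 ≤ ∑ i, q y i * (Measure.pi (fun j =>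
      submissionLaw A dummy x (Function.update c i (some u) j)) E).toReal + (1 - ∑ i, q y i) *
      (Measure.pi (fun j => submissionLaw A dummy x (c j)) E).toReal := fun x y c =>
    add_nonneg (Finset.sum_nonneg fun i _ => mul_nonneg (hq0 y i) ENNReal.toReal_nonneg)
      (mul_nonneg (by linarith [hq1 y]) ENNReal.toReal_nonneg)
  -- A pick pattern of positive weight never names `u`, so `x` and `x'` give the same base product
  -- and differ only in the law that is mixed in.
  have hpt : ∀ y (c : V → Option V), ∏ i, pickProbErase u y i (c i) ≠ 0 →
      ∑ i, q y i * (Measure.pi (fun j => submissionLaw A dummy x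
        (Function.update c i (some u) j)) E).toReal + (1 - ∑ i, q y i) *
        (Measure.pi (fun j => submissionLaw A dummy x (c j)) E).toReal ≤
      Real.exp ε * (∑ i, q y i * (Measure.pi (fun j => submissionLaw A dummy x'
        (Function.update c i (some u) j)) E).toReal + (1 - ∑ i, q y i) *
        (Measure.pi (fun j => submissionLaw A dummy x' (c j)) E).toReal) + δ := by
    intro y c hc
    rw [Finset.prod_ne_zero_iff] at hc
    have hxx : ∀ j, (c j).elim dummy x = (c j).elim dummy x' := by
      intro j
      have := hc j (Finset.mem_univ j)
      cases hj : c j with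
      | none => rfl
      | some l =>
        rw [hj] at this
        exact hx l (eq_of_pickProbErase_ne_zero this).2
    have key := h (fun j => (c j).elim dummy x) (q y) (hq0 y) (hq1 y) (hq2 y) (x u) (x' u) E hE
    rw [mixtureLaw_toReal (hq0 y) (hq1 y), mixtureLaw_toReal (hq0 y) (hq1 y)] at key
    have n1 := hnn x y c
    have n2 := hnn x' y c
    simp only [hup] at n1 n2 ⊢
    simp only [submissionLaw, ← hxx] at n1 n2 ⊢
    rwa [← ENNReal.ofReal_mul (Real.exp_pos _).le,
      ← ENNReal.ofReal_add (mul_nonneg (Real.exp_pos _).le n2) hδ,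
      ENNReal.ofReal_le_ofReal_iff (add_nonneg (mul_nonneg (Real.exp_pos _).le n2) hδ)] at key
  rw [← ENNReal.ofReal_add (mul_nonneg (Real.exp_pos _).le (Finset.sum_nonneg fun y _ =>
    Finset.sum_nonneg fun c _ => mul_nonneg (hw y c) (hnn x' y c))) hδ]
  apply ENNReal.ofReal_le_ofReal
  -- The conditioning weights sum to one, so `δ` survives averaging unchanged.
  have htot : ∑ y, ∑ c : V → Option V,
      configProb G t y * (∏ i, pickProbErase u y i (c i)) * δ = δ := by
    simp only [← Finset.sum_mul, ← Finset.mul_sum, sum_prod_pickProbErase, mul_one,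
      sum_configProb hk hreg, one_mul]
  rw [← htot, Finset.mul_sum, ← Finset.sum_add_distrib]
  refine Finset.sum_le_sum fun y _ => ?_
  rw [Finset.mul_sum, ← Finset.sum_add_distrib]
  refine Finset.sum_le_sum fun c _ => ?_
  by_cases h0 : ∏ i, pickProbErase u y i (c i) = 0
  · simp [h0]
  · have := mul_le_mul_of_nonneg_left (hpt y c h0) (hw y c)
    refine this.trans (le_of_eq ?_)
    ring

end Protocol

/-! ### Privacy parameters and the final guarantees. -/

theorem IsLocalRandomizer.eq_of_zero {D S : Type*} [MeasurableSpace S] {A : D → Measure S}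
    (h : IsLocalRandomizer A 0 0) (x x' : D) : A x = A x' := by
  ext E hE
  refine le_antisymm ?_ ?_
  · simpa using h x x' E hE
  · simpa using h x' x E hE

section Amplification

variable {V : Type*} [Fintype V] [DecidableEq V] {G : SimpleGraph V} [DecidableRel G.Adj]
  {D S : Type*} [MeasurableSpace S] {A : D → Measure S} [∀ x, IsProbabilityMeasure (A x)]

theorem singleEps_nonneg {ε₀ δ Q : ℝ} (hε₀ : 0 ≤ ε₀) (hQ : 0 ≤ Q) : 0 ≤ singleEps ε₀ δ Q := by
  have : 0 ≤ Real.exp ε₀ - 1 := by linarith [Real.one_le_exp hε₀]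
  unfold singleEps
  positivity

/-- This covers `ε₀ = 0`, where `a` may vanish and the Chernoff order `w / (a * Q)` is unavailable.
-/
theorem isDPAt_singleProtocol_of_eq {k : ℕ} (hk : 0 < k) (hreg : G.IsRegularOfDegree k)
    (dummy : D) (t : ℕ) (u : V) (h : ∀ x x' : D, A x = A x') {ε δ : ℝ} (hε : 0 ≤ ε)
    (hδ : 0 ≤ δ) : IsDPAt (singleProtocol G A dummy t) u ε δ := by
  refine isDPAt_singleProtocol_of_mixtureLaw hk hreg dummy t u hδ
    fun d q _ _ _ d₁ d₂ E _ => ?_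
  rw [h d₁ d₂]
  refine le_add_right (le_mul_of_one_le_left' ?_)
  rw [ENNReal.one_le_ofReal]
  exact Real.one_le_exp hε

theorem isDPAt_singleProtocol_of_pure {k : ℕ} (hk : 0 < k) (hreg : G.IsRegularOfDegree k)
    (dummy : D) (t : ℕ) (u : V) {ε₀ δ Q : ℝ} (hε₀ : 0 ≤ ε₀) (hδ : 0 < δ) (hδ1 : δ < 1)
    (hA : IsLocalRandomizer A ε₀ 0) (hQ : collision G t u ≤ Q) :
    IsDPAt (singleProtocol G A dummy t) u (singleEps ε₀ δ Q) δ := by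
  have hQ0 : 0 < Q := (collision_pos hk hreg t u).trans_le hQ
  rcases hε₀.eq_or_lt with rfl | hpos
  · exact isDPAt_singleProtocol_of_eq hk hreg dummy t u hA.eq_of_zero
      (singleEps_nonneg le_rfl hQ0.le) hδ.le
  · exact isDPAt_singleProtocol_of_mixtureLaw hk hreg dummy t u hδ.le
      fun d q hq hq1 hq2 d₁ d₂ => indist_mixtureLaw_of_pure hpos (fun i => hA _ _)
        (fun i => hA _ _) (fun i => hA _ _) (fun i => hA _ _) (hA _ _) (hA _ _) hq hq1
        (hq2.trans hQ) hQ0 hδ hδ1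

theorem deltaThreshold_zero (δ₁ : ℝ) : deltaThreshold 0 δ₁ = 0 := by simp [deltaThreshold]

/-- The quotient of logarithms is nonnegative and `e^ε₀ ≥ 1`, so the denominator is at least `8`.
The bound yields both the smallness needed for clipping and `2 * δ₀ ≤ δ₁`. -/
theorem deltaThreshold_le {ε₀ δ₁ : ℝ} (hε₀ : 0 < ε₀) (hδ₁ : 0 < δ₁) (hδ₁' : δ₁ < 1) :
    deltaThreshold ε₀ δ₁ ≤ (1 - Real.exp (-ε₀)) / 8 * δ₁ := by
  have h1 : 0 < Real.log (2 / δ₁) := Real.log_pos (by rw [lt_div_iff₀ hδ₁]; linarith)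
  have hx : Real.exp (-5 * ε₀) < 1 := by rw [Real.exp_lt_one_iff]; linarith
  have h2 : 0 < Real.log (1 / (1 - Real.exp (-5 * ε₀))) := by
    apply Real.log_pos
    rw [lt_div_iff₀ (by linarith)]
    linarith [Real.exp_pos (-5 * ε₀)]
  have h3 : 0 ≤ Real.log (2 / δ₁) / Real.log (1 / (1 - Real.exp (-5 * ε₀))) := by positivity
  have h4 : 0 < 1 - Real.exp (-ε₀) := by
    have : Real.exp (-ε₀) < 1 := by rw [Real.exp_lt_one_iff]; linarith
    linarith
  have h5 := Real.one_le_exp hε₀.le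
  rw [deltaThreshold, div_mul_eq_mul_div]
  gcongr
  nlinarith

theorem isDPAt_singleProtocol_of_approx {k : ℕ} (hk : 0 < k) (hreg : G.IsRegularOfDegree k)
    (dummy : D) (t : ℕ) (u : V) {ε₀ δ Q δ₀ δ₁ δ₂ a ε' : ℝ} (hε₀ : 0 ≤ ε₀) (hδ : 0 < δ)
    (hδ1 : δ < 1) (hδ₀ : 0 ≤ δ₀) (hδ₁ : 0 < δ₁) (hδ₁' : δ₁ < 1) (hδ₂ : 0 ≤ δ₂)
    (hthr : δ₀ ≤ deltaThreshold ε₀ δ₁) (hA : IsLocalRandomizer A ε₀ δ₀)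
    (hQ : collision G t u ≤ Q) (ha : Real.exp (3 * ε₀) - 1 ≤ a)
    (hε' : ε' = a ^ 2 / 2 * Q + a * Real.sqrt (2 * Real.log (1 / δ) * Q)) :
    IsDPAt (singleProtocol G A dummy t) u ε' (singleDelta (Fintype.card V) ε' δ δ₁ δ₂) := by
  have hQ0 : 0 < Q := (collision_pos hk hreg t u).trans_le hQ
  have hΔ : 0 ≤ singleDelta (Fintype.card V) ε' δ δ₁ δ₂ := by unfold singleDelta; positivity
  rcases hε₀.eq_or_lt with rfl | hpos
  · rw [deltaThreshold_zero] at hthr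
    obtain rfl : δ₀ = 0 := le_antisymm hthr hδ₀
    have ha0 : 0 ≤ a := by simpa using ha
    exact isDPAt_singleProtocol_of_eq hk hreg dummy t u hA.eq_of_zero (by rw [hε']; positivity) hΔ
  · have hn : (1 : ℝ) ≤ Fintype.card V := by
      exact_mod_cast Fintype.card_pos_iff.mpr ⟨u⟩
    have h1 := hthr.trans (deltaThreshold_le hpos hδ₁ hδ₁')
    have h2 : 0 < 1 - Real.exp (-ε₀) := by
      have : Real.exp (-ε₀) < 1 := by rw [Real.exp_lt_one_iff]; linarith
      linarith
    have h3 := Real.exp_pos (-ε₀)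
    have h4 : δ₀ ≤ (1 - Real.exp (-ε₀)) / 8 := h1.trans (by nlinarith)
    have h5 : 2 * δ₀ ≤ δ₁ := by nlinarith
    refine isDPAt_singleProtocol_of_mixtureLaw hk hreg dummy t u hΔ
      fun d q hq hq1 hq2 d₁ d₂ => (indist_mixtureLaw_of_approx hpos hδ₀ h4 (fun i => hA _ _)
        (fun i => hA _ _) (fun i => hA _ _) (fun i => hA _ _) hq hq1
        (hq2.trans hQ) hQ0 hδ hδ1 ha hε').mono le_rfl ?_
    have h6 : 2 * δ₀ ≤ Fintype.card V * δ₁ := h5.trans (le_mul_of_one_le_left hδ₁.le hn)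
    have h7 := mul_le_mul_of_nonneg_left h6 (add_pos (Real.exp_pos ε') one_pos).le
    unfold singleDelta
    linarith

theorem isDP_of_isDPAt {V D Ω : Type*} [MeasurableSpace Ω] {M : (V → D) → Measure Ω} {ε δ : ℝ}
    (h : ∀ u, IsDPAt M u ε δ) : IsDP M ε δ := fun x x' ⟨u, hu⟩ => h u x x' hu

theorem collision_le_iSup (t : ℕ) (u : V) : collision G t u ≤ ⨆ v : V, collision G t v :=
  le_ciSup (Set.finite_range _).bddAbove u

theorem exp_three_mul_sub_one_le {ε₀ : ℝ} (hε₀ : 0 ≤ ε₀) :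
    Real.exp (3 * ε₀) - 1 ≤ Real.exp (8 * ε₀) * (Real.exp (8 * ε₀) - 1) := by
  have h1 : Real.exp (3 * ε₀) ≤ Real.exp (8 * ε₀) := Real.exp_le_exp.mpr (by linarith)
  have h2 : 1 ≤ Real.exp (8 * ε₀) := Real.one_le_exp (by linarith)
  nlinarith

theorem exp_three_mul_sub_one_le_linear {ε₀ : ℝ} (hε₀ : 0 ≤ ε₀) (hε₁ : ε₀ ≤ 1) :
    Real.exp (3 * ε₀) - 1 ≤ 40 * ε₀ := by
  -- On `[0, 3]` the exponential lies below its chord, so `e^(3ε₀) - 1 ≤ ε₀ (e³ - 1)`, and `e³ ≤ 41`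
  -- suffices.
  have h := convexOn_exp.2 (Set.mem_univ 0) (Set.mem_univ 3) (sub_nonneg.mpr hε₁) hε₀ (by ring)
  simp only [smul_eq_mul, mul_zero, zero_add, Real.exp_zero, mul_one] at h
  have h3 : Real.exp 3 ≤ 41 := by
    have e : Real.exp 3 = Real.exp 1 ^ 3 := by rw [← Real.exp_nat_mul]; norm_num
    rw [e]
    calc Real.exp 1 ^ 3 ≤ 3 ^ 3 :=
          pow_le_pow_left₀ (Real.exp_pos _).le (by linarith [Real.exp_one_lt_d9]) 3
      _ ≤ 41 := by norm_num
  rw [mul_comm ε₀ 3] at h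
  nlinarith

end Amplification

theorem mainTheorem4 {V : Type*} [Fintype V] [DecidableEq V]
    (G : SimpleGraph V) [DecidableRel G.Adj] (hconn : G.Connected)
    (k : ℕ) (hk : 0 < k) (hreg : G.IsRegularOfDegree k)
    {D S : Type*} [MeasurableSpace S] (A : D → Measure S) [∀ x, IsProbabilityMeasure (A x)]
    (dummy : D) (t : ℕ) (ε₀ : ℝ) (hε₀ : 0 ≤ ε₀) (δ : ℝ) (hδ : 0 < δ) (hδ1 : δ < 1) :
    (IsLocalRandomizer A ε₀ 0 →
      (∀ u : V, IsDPAt (singleProtocol G A dummy t) u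
        (singleEps ε₀ δ (collision G t u)) δ) ∧
      IsDP (singleProtocol G A dummy t)
        (singleEps ε₀ δ (⨆ u : V, collision G t u)) δ) ∧
    (∀ δ₀ δ₁ δ₂ : ℝ, 0 ≤ δ₀ → 0 < δ₁ → δ₁ < 1 → 0 ≤ δ₂ →
      δ₀ ≤ deltaThreshold ε₀ δ₁ → IsLocalRandomizer A ε₀ δ₀ →
      ((∀ u : V, IsDPAt (singleProtocol G A dummy t) u
          (singleEps (8 * ε₀) δ (collision G t u))
          (singleDelta (Fintype.card V)
            (singleEps (8 * ε₀) δ (collision G t u)) δ δ₁ δ₂)) ∧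
        IsDP (singleProtocol G A dummy t)
          (singleEps (8 * ε₀) δ (⨆ u : V, collision G t u))
          (singleDelta (Fintype.card V)
            (singleEps (8 * ε₀) δ (⨆ u : V, collision G t u)) δ δ₁ δ₂)) ∧
      (ε₀ ≤ 1 →
        (∀ u : V, IsDPAt (singleProtocol G A dummy t) u
          (singleEpsSmall ε₀ δ (collision G t u))
          (singleDelta (Fintype.card V)
            (singleEpsSmall ε₀ δ (collision G t u)) δ δ₁ δ₂)) ∧
        IsDP (singleProtocol G A dummy t)
          (singleEpsSmall ε₀ δ (⨆ u : V, collision G t u))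
          (singleDelta (Fintype.card V)
            (singleEpsSmall ε₀ δ (⨆ u : V, collision G t u)) δ δ₁ δ₂))) := by
  have e1 : ∀ Q, singleEps (8 * ε₀) δ Q = (Real.exp (8 * ε₀) * (Real.exp (8 * ε₀) - 1)) ^ 2 / 2 * Q +
      Real.exp (8 * ε₀) * (Real.exp (8 * ε₀) - 1) * Real.sqrt (2 * Real.log (1 / δ) * Q) := by
    intro Q
    rw [singleEps, show Real.exp (2 * (8 * ε₀)) = Real.exp (8 * ε₀) ^ 2 by
      rw [← Real.exp_nat_mul]; norm_cast]
    ring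
  have e2 : ∀ Q, singleEpsSmall ε₀ δ Q = (40 * ε₀) ^ 2 / 2 * Q +
      40 * ε₀ * Real.sqrt (2 * Real.log (1 / δ) * Q) := by
    intro Q
    rw [singleEpsSmall]
    ring
  refine ⟨fun hA => ⟨fun u => ?_, isDP_of_isDPAt fun u => ?_⟩,
    fun δ₀ δ₁ δ₂ hδ₀ hδ₁ hδ₁' hδ₂ hthr hA => ⟨⟨fun u => ?_, isDP_of_isDPAt fun u => ?_⟩,
      fun hε₁ => ⟨fun u => ?_, isDP_of_isDPAt fun u => ?_⟩⟩⟩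
  · exact isDPAt_singleProtocol_of_pure hk hreg dummy t u hε₀ hδ hδ1 hA le_rfl
  · exact isDPAt_singleProtocol_of_pure hk hreg dummy t u hε₀ hδ hδ1 hA (collision_le_iSup t u)
  · exact isDPAt_singleProtocol_of_approx hk hreg dummy t u hε₀ hδ hδ1 hδ₀ hδ₁ hδ₁' hδ₂ hthr hA
      le_rfl (exp_three_mul_sub_one_le hε₀) (e1 _)
  · exact isDPAt_singleProtocol_of_approx hk hreg dummy t u hε₀ hδ hδ1 hδ₀ hδ₁ hδ₁' hδ₂ hthr hA
      (collision_le_iSup t u) (exp_three_mul_sub_one_le hε₀) (e1 _)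
  · exact isDPAt_singleProtocol_of_approx hk hreg dummy t u hε₀ hδ hδ1 hδ₀ hδ₁ hδ₁' hδ₂ hthr hA
      le_rfl (exp_three_mul_sub_one_le_linear hε₀ hε₁) (e2 _)
  · exact isDPAt_singleProtocol_of_approx hk hreg dummy t u hε₀ hδ hδ1 hδ₀ hδ₁ hδ₁' hδ₂ hthr hA
      (collision_le_iSup t u) (exp_three_mul_sub_one_le_linear hε₀ hε₁) (e2 _)
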